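/- **Theorem 1 (Schwartz's Poncelet grid theorem).** Regard $\mathbb R^2$ as an affine chart of $\mathbb{RP}^2$. Let $\gamma,\Gamma\subset\mathbb R^2$ be nested ellipses, $\gamma$ strictly inside $\Gamma$. If no projective transformation takes $\gamma,\Gamma$ to a pair of concentric circles, then the complexifications of $\gamma$ and $\Gamma$ have exactly four common tangent lines in $\mathbb{CP}^2$. Moreover, there is a projective transformation $T$ of $\mathbb{RP}^2$, depending only on $\gamma$ and $\Gamma$, that takes $\gamma$ and $\Gamma$ to confocal ellipses (possibly concentric circles), centred at the origin and with axes along the coordinate axes, such that the following holds. Let $n\ge 3$ be odd and consider a Poncelet $n$-gon: a closed polygon (convex or star-shaped) with $n$ distinct vertices on $\Gamma$, all of whose side lines are tangent to $\gamma$. Let $\ell_i$, $i\in\mathbb Z/n$, be the lines containing its sides, enumerated so that their tangency points with $\gamma$ are in cyclic order; let $\ell_i\cap\ell_i$ denote the tangency point of $\ell_i$ with $\gamma$, and put $$P_k=\bigcup_{i-j=k}\ell_i\cap\ell_j,\qquad Q_k=\bigcup_{i+j=k}\ell_i\cap\ell_j\qquad(k\in\mathbb Z/n),$$ where the intersections are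 taken in $\mathbb{RP}^2$. 1. There are conics $E_0,\dots,E_{(n-1)/2}$ with $P_k\subset E_k$ such that the $T(E_k)$ are nested ellipses: $T(E_j)$ is strictly inside $T(E_k)$ for $j<k$. Every common complex tangent line of $\gamma$ and $\Gamma$ is tangent to the complexification of every $E_k$. 2. The sets $P_k$ are all projectively equivalent to each other; indeed, for all $j,k$ some invertible linear map of $\mathbb R^2$ takes $T(P_j)$ onto $T(P_k)$. 3. Suppose that no projective transformation other than the identity preserves $\gamma$, $\Gamma$ and the polygon. Then there are nondegenerate hyperbolas $H_k$, $k\in\mathbb Z/n$, pairwise disjoint in $\mathbb{RP}^2$, with $Q_k\subset H_k$; the images $T(H_k)$ are hyperbolas too; and every common complex tangent line of $\gamma$ and $\Gamma$ is tangent to the complexification of every $H_k$. The sets $Q_k$ are all projectively equivalent to each other; indeed, for all $j,k$ some invertible linear map of $\mathbb R^2$ takes $T(Q_j)$ onto $T(Q_k)$. -/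

import Mathlib

open scoped LinearAlgebra.Projectivization Pointwise Matrix

noncomputable section

namespace PonceletGrid

/-- Symmetric `3 × 3` matrices are the conics of the projective plane. -/
abbrev Mat (K : Type*) := Matrix (Fin 3) (Fin 3) K

/-- The projective plane over `K`, in homogeneous coordinates `[x : y : z]`.
The affine plane is the chart `z ≠ 0`, the line at infinity is `z = 0`. -/
abbrev Plane (K : Type*) [Field K] := ℙ K (Fin 3 → K)

/-- Lines of the projective plane: `[a : b : c]` stands for the line `a x + b y + c z = 0`. -/
abbrev Line (K : Type*) [Field K] := ℙ K (Fin 3 → K)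

/-- The point `p` lies on the line `u`. -/
def OnLine {K : Type*} [Field K] (p : Plane K) (u : Line K) : Prop :=
  Projectivization.orthogonal u p

/-- The quadratic form of the matrix `M`. -/
def quad {K : Type*} [Field K] (M : Mat K) (w : Fin 3 → K) : K := w ⬝ᵥ (M *ᵥ w)

theorem quad_smul {K : Type*} [Field K] (M : Mat K) (c : K) (w : Fin 3 → K) :
    quad M (c • w) = c ^ 2 * quad M w := by
  simp only [quad, Matrix.mulVec_smul, smul_dotProduct, dotProduct_smul, smul_eq_mul]
  ring

/-- The points of the conic with matrix `M`. -/
def locus {K : Type*} [Field K] (M : Mat K) : Set (Plane K) := {p | quad M p.rep = 0}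

/-- A line is tangent to a (nondegenerate) conic if it has exactly one point in common with it. -/
def IsTangent {K : Type*} [Field K] (M : Mat K) (u : Line K) : Prop :=
  ∃! p : Plane K, OnLine p u ∧ p ∈ locus M

/-- The complexification of a real conic. -/
def complexify (M : Mat ℝ) : Mat ℂ := M.map Complex.ofReal

/-- The equation of a real ellipse (with nonempty locus) in the affine plane `z ≠ 0`;
circles are ellipses. -/
def IsEllipse (M : Mat ℝ) : Prop :=
  M.IsSymm ∧ 0 < M 0 0 * M 1 1 - M 0 1 ^ 2 ∧ (M 0 0 + M 1 1) * M.det < 0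

/-- The equation of a nondegenerate hyperbola in the affine plane `z ≠ 0`. -/
def IsHyperbola (M : Mat ℝ) : Prop :=
  M.IsSymm ∧ M 0 0 * M 1 1 - M 0 1 ^ 2 < 0 ∧ M.det ≠ 0

/-- The point `p` lies in the open region bounded by the ellipse `M`: there the quadratic form has
the sign opposite to the one of its definite restriction to `z = 0`. -/
def Inside (M : Mat ℝ) (p : Plane ℝ) : Prop := (M 0 0 + M 1 1) * quad M p.rep < 0

/-- The ellipse `M`, with its interior, is contained in the interior of the ellipse `N`. -/
def Nested (M N : Mat ℝ) : Prop := ∀ p : Plane ℝ, p ∈ locus M ∨ Inside M p → Inside N p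

/-- The image of the conic `M` under the projective transformation `g`. -/
def conicImage (g : GL (Fin 3) ℝ) (M : Mat ℝ) : Mat ℝ :=
  ((g⁻¹ : GL (Fin 3) ℝ) : Mat ℝ)ᵀ * M * ((g⁻¹ : GL (Fin 3) ℝ) : Mat ℝ)

/-- The conic `x² / a + y² / b = 1`. -/
def axisConic (a b : ℝ) : Mat ℝ := Matrix.diagonal ![1 / a, 1 / b, -1]

/-- `M` and `N` are the ellipses `x² / a + y² / b = 1` and `x² / (a + c) + y² / (b + c) = 1`
of one confocal family (concentric circles if `a = b`). -/
def AreConfocal (M N : Mat ℝ) : Prop :=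
  ∃ a b c : ℝ, 0 < a ∧ 0 < b ∧ 0 < c ∧
    locus M = locus (axisConic a b) ∧ locus N = locus (axisConic (a + c) (b + c))

/-- Some projective transformation takes `M` and `N` to concentric circles. -/
def ProjectivelyConcentric (M N : Mat ℝ) : Prop :=
  ∃ (g : GL (Fin 3) ℝ) (r s : ℝ), 0 < r ∧ 0 < s ∧
    g • locus M = locus (axisConic (r ^ 2) (r ^ 2)) ∧
    g • locus N = locus (axisConic (s ^ 2) (s ^ 2))

/-- The line `u` contains a side of the closed polygon with consecutive vertices `v i`. -/
def IsSide {n : ℕ} (v : ZMod n → Plane ℝ) (u : Line ℝ) : Prop :=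
  ∃ i, OnLine (v i) u ∧ OnLine (v (i + 1)) u

/-- `v` is a polygon with `n` distinct vertices, inscribed into `Γ` and circumscribed about `γ`
(convex or star-shaped). -/
def IsPonceletPolygon {n : ℕ} (γ Γ : Mat ℝ) (v : ZMod n → Plane ℝ) : Prop :=
  Function.Injective v ∧ (∀ i, v i ∈ locus Γ) ∧ ∀ u, IsSide v u → IsTangent γ u

/-- The point `[cos t : sin t : 1]` of the unit circle. -/
def circlePoint (t : ℝ) : Plane ℝ :=
  Projectivization.mk ℝ ![Real.cos t, Real.sin t, 1]
    (fun h => one_ne_zero (α := ℝ) (by simpa using congrFun h 2))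

/-- The lines `ℓ i`, with cyclic indices, are the lines containing the sides of `v`, enumerated so
that their tangency points with `γ` are in cyclic order. The cyclic order on `γ` (in one or the
other direction) is the one of the unit circle, carried over by a projective transformation `g`;
`θ` is the angle of the tangency points, lifted to the real line. -/
def IsCyclicEnumeration {n : ℕ} (γ : Mat ℝ) (v : ZMod n → Plane ℝ) (ℓ : ZMod n → Line ℝ) : Prop :=
  Set.range ℓ = {u | IsSide v u} ∧
    ∃ (g : GL (Fin 3) ℝ) (θ : ℤ → ℝ),
      g • Set.range circlePoint = locus γ ∧
      StrictMono θ ∧ (∀ i, θ (i + n) = θ i + 2 * Real.pi) ∧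
      ∀ i : ℤ, OnLine (g • circlePoint (θ i)) (ℓ (i : ZMod n))

/-- `ℓ i ∩ ℓ j`, where `ℓ i ∩ ℓ i` means the tangency point of `ℓ i` with `γ`. -/
def gridPoint {n : ℕ} (γ : Mat ℝ) (ℓ : ZMod n → Line ℝ) (i j : ZMod n) : Set (Plane ℝ) :=
  {p | OnLine p (ℓ i) ∧ OnLine p (ℓ j) ∧ (i = j → p ∈ locus γ)}

/-- The set `P_k`. -/
def gridP {n : ℕ} (γ : Mat ℝ) (ℓ : ZMod n → Line ℝ) (k : ZMod n) : Set (Plane ℝ) :=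
  {p | ∃ i j, i - j = k ∧ p ∈ gridPoint γ ℓ i j}

/-- The set `Q_k`. -/
def gridQ {n : ℕ} (γ : Mat ℝ) (ℓ : ZMod n → Line ℝ) (k : ZMod n) : Set (Plane ℝ) :=
  {p | ∃ i j, i + j = k ∧ p ∈ gridPoint γ ℓ i j}

/-- The projective transformation `g` is a linear map of the affine plane `z ≠ 0`. -/
def IsLinear (g : GL (Fin 3) ℝ) : Prop :=
  g 0 2 = 0 ∧ g 1 2 = 0 ∧ g 2 0 = 0 ∧ g 2 1 = 0 ∧ g 2 2 = 1

/-- In the affine coordinates given by `T`, a linear map takes `A` onto `B`. In particular the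
projective transformation `T⁻¹ g T` takes `A` onto `B`. -/
def LinearlyEquivalent (T : GL (Fin 3) ℝ) (A B : Set (Plane ℝ)) : Prop :=
  ∃ g : GL (Fin 3) ℝ, IsLinear g ∧ (T⁻¹ * g * T) • A = B

/-- No projective transformation other than the identity preserves `γ`, `Γ` and the polygon. -/
def HasNoSymmetry {n : ℕ} (γ Γ : Mat ℝ) (v : ZMod n → Plane ℝ) : Prop :=
  ∀ g : GL (Fin 3) ℝ, g • locus γ = locus γ → g • locus Γ = locus Γ →
    g • Set.range v = Set.range v → ∀ p : Plane ℝ, g • p = p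

/-- The complex lines that are tangent to both complexified conics. -/
def commonTangents (M N : Mat ℝ) : Set (Line ℂ) :=
  {u | IsTangent (complexify M) u ∧ IsTangent (complexify N) u}

end PonceletGrid

end

/- A projective transformation takes `γ` to the unit circle and `Γ` to an ellipse
`x² / A + y² / B = 1` with `1 < A ≤ B`. The tangent lines of the unit circle are parametrised by
`u ↦ [sn u : cn u : -1]`, with the Jacobi functions of parameter `m = 1 - (A - 1) / (B - 1)`, and by
the addition theorem the two tangent lines from a point of the ellipse belong to parameters with a
constant difference. Hence the sides of a Poncelet `n`-gon are the tangent lines at `u₀ + 2 i δ`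
with `n δ = ± 2 K`.

The tangent lines at `x + y` and `x - y` meet in the point `[sn x dn y : cn x : cn y]`. On `P_k` the
parameter `y` is constant, on `Q_k` the parameter `x` is constant; so these sets lie on the curves
`y = const` and `x = const`, which are conics tangent to the common tangents of `γ` and `Γ`, and
diagonal matrices relate all the `P_k` and all the `Q_k`. Scaling one axis by `√(1 - m)` makes the
family confocal. -/

noncomputable section

namespace PonceletGrid

section Incidence

variable {K : Type*} [Field K]

theorem exists_smul_cross_eq {p q u : Fin 3 → K} (hpq : p ⨯₃ q ≠ 0) (hp : u ⬝ᵥ p = 0)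
    (hq : u ⬝ᵥ q = 0) : ∃ a : K, a • p ⨯₃ q = u := by
  have h : p ⨯₃ q ⨯₃ u = 0 := by
    rw [cross_cross_eq_smul_sub_smul, dotProduct_comm, hp, dotProduct_comm, hq]
    simp
  by_contra! ha
  exact crossProduct_ne_zero_iff_linearIndependent.2
    ((LinearIndependent.pair_iff' hpq).2 ha) h

theorem exists_smul_add_smul_eq {p q u r : Fin 3 → K} (hu : u ≠ 0) (hpq : p ⨯₃ q ≠ 0)
    (hp : u ⬝ᵥ p = 0) (hq : u ⬝ᵥ q = 0) (hr : u ⬝ᵥ r = 0) : ∃ a b : K, a • p + b • q = r := by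
  have hdet : Matrix.det ![r, p, q] = 0 := by
    obtain ⟨a, rfl⟩ := exists_smul_cross_eq hpq hp hq
    have ha : a ≠ 0 := fun ha => hu (by rw [ha, zero_smul])
    rw [← triple_product_eq_det, dotProduct_comm]
    simpa [ha] using hr
  by_contra hspan
  rw [← Submodule.mem_span_pair, ← Matrix.range_cons_cons_empty p q ![]] at hspan
  have hli : LinearIndependent K ![r, p, q] :=
    linearIndependent_finCons.2 ⟨crossProduct_ne_zero_iff_linearIndependent.1 hpq, hspan⟩
  exact (Matrix.isUnit_iff_isUnit_det (A := ![r, p, q])).1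
    (Matrix.linearIndependent_rows_iff_isUnit.1 hli) |>.ne_zero hdet

theorem exists_dotProduct_eq_zero_cross_ne_zero (u : Fin 3 → K) {p : Fin 3 → K} (hp : p ≠ 0) :
    ∃ q, u ⬝ᵥ q = 0 ∧ p ⨯₃ q ≠ 0 := by
  let f : (Fin 3 → K) →ₗ[K] K := dotProductBilin K K u
  by_contra! h
  have hker : LinearMap.ker f ≤ Submodule.span K {p} := fun q hq => by
    by_contra hspan
    refine crossProduct_ne_zero_iff_linearIndependent.2 ((LinearIndependent.pair_iff' hp).2 ?_)
      (h q hq)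
    exact fun a ha => hspan (Submodule.mem_span_singleton.2 ⟨a, ha⟩)
  have h1 := Submodule.finrank_mono hker
  have h2 := f.finrank_range_add_finrank_ker
  have h3 := Submodule.finrank_le (LinearMap.range f)
  rw [finrank_span_singleton hp] at h1
  rw [Module.finrank_fin_fun] at h2
  rw [Module.finrank_self] at h3
  omega

theorem onLine_mk {p u : Fin 3 → K} (hp : p ≠ 0) (hu : u ≠ 0) :
    OnLine (Projectivization.mk K p hp) (Projectivization.mk K u hu) ↔ u ⬝ᵥ p = 0 :=
  Iff.rfl

theorem mk_eq_mk_of_smul_eq {v w : Fin 3 → K} (hv : v ≠ 0) (hw : w ≠ 0) {a : K} (h : a • w = v) :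
    Projectivization.mk K v hv = Projectivization.mk K w hw :=
  (Projectivization.mk_eq_mk_iff' K v w hv hw).2 ⟨a, h⟩

theorem cross_ne_zero_of_mk_ne {p q : Fin 3 → K} {hp : p ≠ 0} {hq : q ≠ 0}
    (h : Projectivization.mk K p hp ≠ Projectivization.mk K q hq) : p ⨯₃ q ≠ 0 := by
  rwa [ne_eq, Projectivization.mk_eq_mk_iff_crossProduct_eq_zero] at h

theorem eq_of_onLine_of_onLine {p q : Plane K} {u w : Line K} (huw : u ≠ w) (hpu : OnLine p u)
    (hpw : OnLine p w) (hqu : OnLine q u) (hqw : OnLine q w) : p = q := by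
  induction p using Projectivization.ind with | h p hp =>
  induction q using Projectivization.ind with | h q hq =>
  induction u using Projectivization.ind with | h u hu =>
  induction w using Projectivization.ind with | h w hw =>
  rw [onLine_mk] at hpu hpw hqu hqw
  by_contra hpq
  have hc := cross_ne_zero_of_mk_ne hpq
  obtain ⟨a, ha⟩ := exists_smul_cross_eq hc hpu hqu
  obtain ⟨b, hb⟩ := exists_smul_cross_eq hc hpw hqw
  exact huw ((mk_eq_mk_of_smul_eq hu hc ha).trans (mk_eq_mk_of_smul_eq hw hc hb).symm)

theorem exists_onLine (p q : Plane K) : ∃ u : Line K, OnLine p u ∧ OnLine q u := by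
  classical
  by_cases h : p = q
  · subst h
    induction p using Projectivization.ind with | h p hp =>
    obtain ⟨u, hu, hpu⟩ := exists_dotProduct_eq_zero_cross_ne_zero p hp
    have hu0 : u ≠ 0 := fun h0 => hpu (by rw [h0, map_zero])
    have hon := (onLine_mk hp hu0).2 ((dotProduct_comm _ _).trans hu)
    exact ⟨_, hon, hon⟩
  · exact ⟨Projectivization.cross p q, Projectivization.cross_orthogonal_left h,
      Projectivization.cross_orthogonal_right h⟩

theorem mulVec_ne_zero (g : GL (Fin 3) K) {w : Fin 3 → K} (hw : w ≠ 0) :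
    (g : Mat K) *ᵥ w ≠ 0 :=
  (smul_ne_zero_iff_ne g).mpr hw

theorem smul_mk (g : GL (Fin 3) K) {w : Fin 3 → K} (hw : w ≠ 0) :
    g • Projectivization.mk K w hw =
      Projectivization.mk K ((g : Mat K) *ᵥ w) (mulVec_ne_zero g hw) :=
  rfl

/-- The action of a projective transformation on line coordinates: `g` takes the line `u` to the
line `dual g • u`. -/
def dual (g : GL (Fin 3) K) : GL (Fin 3) K where
  val := ((g⁻¹ : GL (Fin 3) K) : Mat K)ᵀ
  inv := (g : Mat K)ᵀ
  val_inv := by rw [← Matrix.transpose_mul, ← Units.val_mul]; simp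
  inv_val := by rw [← Matrix.transpose_mul, ← Units.val_mul]; simp

theorem val_dual (g : GL (Fin 3) K) : (dual g : Mat K) = ((g⁻¹ : GL (Fin 3) K) : Mat K)ᵀ := rfl

theorem smul_onLine_dual_smul (g : GL (Fin 3) K) (p : Plane K) (u : Line K) :
    OnLine (g • p) (dual g • u) ↔ OnLine p u := by
  induction p using Projectivization.ind with | h p hp =>
  induction u using Projectivization.ind with | h u hu =>
  rw [smul_mk, smul_mk, onLine_mk, onLine_mk, val_dual, Matrix.mulVec_transpose,
    ← Matrix.dotProduct_mulVec, Matrix.mulVec_mulVec, ← Units.val_mul]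
  simp

theorem onLine_dual_smul (g : GL (Fin 3) K) (p : Plane K) (u : Line K) :
    OnLine p (dual g • u) ↔ OnLine (g⁻¹ • p) u := by
  rw [← smul_onLine_dual_smul g (g⁻¹ • p), smul_inv_smul]

end Incidence

section Conic

theorem dotProduct_mulVec_comm {n R : Type*} [Fintype n] [CommSemiring R] {M : Matrix n n R}
    (hM : M.IsSymm) (p q : n → R) : q ⬝ᵥ (M *ᵥ p) = p ⬝ᵥ (M *ᵥ q) := by
  rw [Matrix.dotProduct_mulVec, ← Matrix.mulVec_transpose, hM.eq, dotProduct_comm]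

variable {K : Type*} [Field K] {M : Mat K}

theorem mk_mem_locus {w : Fin 3 → K} (hw : w ≠ 0) :
    Projectivization.mk K w hw ∈ locus M ↔ quad M w = 0 := by
  obtain ⟨a, ha⟩ := Projectivization.exists_smul_eq_mk_rep K w hw
  have : (Projectivization.mk K w hw).rep = (a : K) • w := ha.symm
  simp [locus, this, quad_smul]

theorem quad_mulVec (M G : Mat K) (w : Fin 3 → K) : quad M (G *ᵥ w) = quad (Gᵀ * M * G) w := by
  simp only [quad, ← Matrix.mulVec_mulVec]
  rw [Matrix.mulVec_transpose, dotProduct_comm, Matrix.dotProduct_mulVec, dotProduct_comm]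

theorem quad_smul_matrix (s : K) (M : Mat K) (w : Fin 3 → K) : quad (s • M) w = s * quad M w := by
  rw [quad, Matrix.smul_mulVec, dotProduct_smul, smul_eq_mul, quad]

theorem quad_add_smul (hM : M.IsSymm) (p q : Fin 3 → K) (a b : K) :
    quad M (a • p + b • q) =
      a ^ 2 * quad M p + 2 * a * b * (p ⬝ᵥ (M *ᵥ q)) + b ^ 2 * quad M q := by
  simp only [quad, Matrix.mulVec_add, Matrix.mulVec_smul, add_dotProduct, dotProduct_add,
    smul_dotProduct, dotProduct_smul, smul_eq_mul, dotProduct_mulVec_comm hM p q]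
  ring

-- Up to sign, this is the discriminant of the restriction of `quad M` to the line through `p`, `q`.
theorem quad_adjugate_cross (hM : M.IsSymm) (p q : Fin 3 → K) :
    quad M.adjugate (p ⨯₃ q) = quad M p * quad M q - (p ⬝ᵥ (M *ᵥ q)) ^ 2 := by
  have h01 := hM.apply 0 1
  have h02 := hM.apply 0 2
  have h12 := hM.apply 1 2
  simp only [quad, Matrix.adjugate_fin_three, cross_apply, Matrix.mulVec, dotProduct,
    Fin.sum_univ_three, Matrix.of_apply, Matrix.cons_val_zero, Matrix.cons_val_one,
    Matrix.cons_val, h01, h02, h12]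
  ring

theorem det_eq_zero_of_isotropic (hM : M.IsSymm) {p q : Fin 3 → K} (hpq : p ⨯₃ q ≠ 0)
    (hp : quad M p = 0) (hq : quad M q = 0) (hB : p ⬝ᵥ (M *ᵥ q) = 0) : M.det = 0 := by
  have hB' : q ⬝ᵥ (M *ᵥ p) = 0 := (dotProduct_mulVec_comm hM p q).trans hB
  rw [quad, dotProduct_comm] at hp hq
  rw [dotProduct_comm] at hB hB'
  obtain ⟨a, ha⟩ := exists_smul_cross_eq hpq hp hB'
  obtain ⟨b, hb⟩ := exists_smul_cross_eq hpq hB hq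
  by_contra hdet
  have hinj {x : Fin 3 → K} : M *ᵥ x = 0 → x = 0 := Matrix.eq_zero_of_mulVec_eq_zero hdet
  have hdep : M *ᵥ (b • p + (-a) • q) = 0 := by
    rw [Matrix.mulVec_add, Matrix.mulVec_smul, Matrix.mulVec_smul, ← ha, ← hb, smul_smul,
      smul_smul, ← add_smul, neg_mul, mul_comm, add_neg_cancel, zero_smul]
  have ha0 : a = 0 := by
    have hcross : p ⨯₃ (b • p + (-a) • q) = 0 := by rw [hinj hdep, map_zero]
    simpa [hpq] using hcross
  have hp0 : p = 0 := hinj (by rw [← ha, ha0, zero_smul])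
  exact hpq (by rw [hp0, map_zero, LinearMap.zero_apply])

variable [NeZero (2 : K)]

theorem eq_or_eq_of_onLine_of_mem_locus (hM : M.IsSymm) (hdet : M.det ≠ 0)
    {p q r : Plane K} {u : Line K} (hpq : p ≠ q) (hpu : OnLine p u) (hqu : OnLine q u)
    (hru : OnLine r u) (hp : p ∈ locus M) (hq : q ∈ locus M) (hr : r ∈ locus M) :
    r = p ∨ r = q := by
  induction p using Projectivization.ind with | h p hp0 =>
  induction q using Projectivization.ind with | h q hq0 =>
  induction r using Projectivization.ind with | h r hr0 =>
  induction u using Projectivization.ind with | h u hu0 =>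
  rw [onLine_mk] at hpu hqu hru
  rw [mk_mem_locus] at hp hq hr
  have hc := cross_ne_zero_of_mk_ne hpq
  obtain ⟨a, b, rfl⟩ := exists_smul_add_smul_eq hu0 hc hpu hqu hru
  rw [quad_add_smul hM, hp, hq] at hr
  have hB : p ⬝ᵥ (M *ᵥ q) ≠ 0 := fun hB => hdet (det_eq_zero_of_isotropic hM hc hp hq hB)
  have hab : a = 0 ∨ b = 0 := by simpa [hB, NeZero.ne (2 : K)] using hr
  rcases hab with rfl | rfl
  · exact Or.inr (mk_eq_mk_of_smul_eq (a := b) _ _ (by simp))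
  · exact Or.inl (mk_eq_mk_of_smul_eq (a := a) _ _ (by simp))

-- If the discriminant were nonzero, `quad M q • p - (2 * B) • q` would be a second common point.
theorem quad_adjugate_eq_zero_of_isTangent (hM : M.IsSymm) {u : Fin 3 → K} (hu : u ≠ 0)
    (h : IsTangent M (Projectivization.mk K u hu)) : quad M.adjugate u = 0 := by
  obtain ⟨p, ⟨hpu, hpM⟩, huniq⟩ := h
  induction p using Projectivization.ind with | h p hp0 =>
  rw [onLine_mk] at hpu
  rw [mk_mem_locus] at hpM
  obtain ⟨q, hqu, hpq⟩ := exists_dotProduct_eq_zero_cross_ne_zero u hp0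
  set B := p ⬝ᵥ (M *ᵥ q)
  have hB : B = 0 := by
    by_contra hB
    set r : Fin 3 → K := quad M q • p + (-(2 * B)) • q with hr
    have hpr : p ⨯₃ r ≠ 0 := by
      simp [hr, hpq, hB, NeZero.ne (2 : K)]
    have hr0 : r ≠ 0 := by
      rintro h0
      exact hpr (by rw [h0, map_zero])
    have hrM : quad M r = 0 := by rw [hr, quad_add_smul hM, hpM]; ring
    have hru : u ⬝ᵥ r = 0 := by simp [hr, hpu, hqu]
    exact hpr ((Projectivization.mk_eq_mk_iff_crossProduct_eq_zero hp0 hr0).1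
      (huniq _ ⟨(onLine_mk hr0 hu).2 hru, (mk_mem_locus hr0).2 hrM⟩).symm)
  obtain ⟨a, rfl⟩ := exists_smul_cross_eq hpq hpu hqu
  rw [quad_smul, quad_adjugate_cross hM, hpM, show p ⬝ᵥ (M *ᵥ q) = 0 from hB]
  ring

theorem isTangent_mk_iff (hM : M.IsSymm) (hdet : M.det ≠ 0) {u : Fin 3 → K} (hu : u ≠ 0) :
    IsTangent M (Projectivization.mk K u hu) ↔ quad M.adjugate u = 0 := by
  refine ⟨quad_adjugate_eq_zero_of_isTangent hM hu, fun h => ?_⟩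
  have hadj : M *ᵥ (M.adjugate *ᵥ u) = M.det • u := by
    rw [Matrix.mulVec_mulVec, Matrix.mul_adjugate, Matrix.smul_mulVec, Matrix.one_mulVec]
  have hp0 : M.adjugate *ᵥ u ≠ 0 := fun h0 => smul_ne_zero hdet hu (by
    rw [← hadj, h0, Matrix.mulVec_zero])
  have hpM : quad M (M.adjugate *ᵥ u) = 0 := by
    rw [quad, hadj, dotProduct_smul, dotProduct_comm]
    exact smul_eq_zero_of_right _ h
  refine ⟨Projectivization.mk K _ hp0, ⟨(onLine_mk _ _).2 h, (mk_mem_locus _).2 hpM⟩, ?_⟩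
  rintro q ⟨hqu, hqM⟩
  induction q using Projectivization.ind with | h q hq0 =>
  rw [onLine_mk] at hqu
  rw [mk_mem_locus] at hqM
  by_contra hqp
  refine hdet (det_eq_zero_of_isotropic hM (cross_ne_zero_of_mk_ne hqp) hqM hpM ?_)
  rw [hadj, dotProduct_smul, dotProduct_comm, hqu, smul_zero]

end Conic

section Transport

theorem smul_mem_locus_conicImage (g : GL (Fin 3) ℝ) (M : Mat ℝ) (p : Plane ℝ) :
    g • p ∈ locus (conicImage g M) ↔ p ∈ locus M := by
  induction p using Projectivization.ind with | h p hp =>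
  rw [smul_mk, mk_mem_locus, mk_mem_locus, conicImage, ← quad_mulVec, Matrix.mulVec_mulVec,
    ← Units.val_mul]
  simp

theorem smul_locus (g : GL (Fin 3) ℝ) (M : Mat ℝ) : g • locus M = locus (conicImage g M) := by
  ext p
  rw [Set.mem_smul_set_iff_inv_smul_mem, ← smul_mem_locus_conicImage g, smul_inv_smul]

theorem conicImage_mul (g h : GL (Fin 3) ℝ) (M : Mat ℝ) :
    conicImage (g * h) M = conicImage g (conicImage h M) := by
  simp only [conicImage, mul_inv_rev, Units.val_mul, Matrix.transpose_mul, Matrix.mul_assoc]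

theorem conicImage_one (M : Mat ℝ) : conicImage 1 M = M := by
  simp [conicImage]

theorem conicImage_inv (g : GL (Fin 3) ℝ) (M : Mat ℝ) :
    conicImage g⁻¹ M = (g : Mat ℝ)ᵀ * M * (g : Mat ℝ) := by
  rw [conicImage, inv_inv]

theorem isSymm_conicImage {M : Mat ℝ} (hM : M.IsSymm) (g : GL (Fin 3) ℝ) :
    (conicImage g M).IsSymm := by
  rw [Matrix.IsSymm, conicImage, Matrix.transpose_mul, Matrix.transpose_mul, hM.eq,
    Matrix.transpose_transpose, Matrix.mul_assoc]

theorem det_conicImage_ne_zero {M : Mat ℝ} (hM : M.det ≠ 0) (g : GL (Fin 3) ℝ) :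
    (conicImage g M).det ≠ 0 := by
  have h : ((g⁻¹ : GL (Fin 3) ℝ) : Mat ℝ).det ≠ 0 :=
    ((Matrix.isUnit_iff_isUnit_det _).1 (Units.isUnit g⁻¹)).ne_zero
  rw [conicImage, Matrix.det_mul, Matrix.det_mul, Matrix.det_transpose]
  exact mul_ne_zero (mul_ne_zero h hM) h

theorem locus_smul {c : ℝ} (hc : c ≠ 0) (M : Mat ℝ) : locus (c • M) = locus M := by
  ext p
  simp [locus, quad, Matrix.smul_mulVec, hc]

theorem isTangent_dual_smul {g : GL (Fin 3) ℝ} {M N : Mat ℝ} (h : g • locus M = locus N)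
    (u : Line ℝ) : IsTangent N (dual g • u) ↔ IsTangent M u := by
  have key (p : Plane ℝ) : OnLine p (dual g • u) ∧ p ∈ locus N ↔
      OnLine (g⁻¹ • p) u ∧ g⁻¹ • p ∈ locus M := by
    rw [onLine_dual_smul, ← h, Set.mem_smul_set_iff_inv_smul_mem]
  simp only [IsTangent, key]
  exact (Function.Bijective.existsUnique_iff (MulAction.bijective (β := Plane ℝ) g⁻¹)
    (p := fun p => OnLine p u ∧ p ∈ locus M)).symm

variable {n : ℕ} {g : GL (Fin 3) ℝ} {γ γ' Γ Γ' : Mat ℝ} {v : ZMod n → Plane ℝ}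
  {ℓ : ZMod n → Line ℝ}

theorem isSide_dual_smul (g : GL (Fin 3) ℝ) (v : ZMod n → Plane ℝ) (u : Line ℝ) :
    IsSide (fun i => g • v i) (dual g • u) ↔ IsSide v u := by
  simp only [IsSide, smul_onLine_dual_smul]

theorem IsPonceletPolygon.smul (hv : IsPonceletPolygon γ Γ v) (hγ : g • locus γ = locus γ')
    (hΓ : g • locus Γ = locus Γ') : IsPonceletPolygon γ' Γ' (fun i => g • v i) := by
  refine ⟨(MulAction.injective g).comp hv.1, fun i => ?_, fun u hu => ?_⟩
  · rw [← hΓ]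
    exact Set.smul_mem_smul_set (hv.2.1 i)
  · rw [← smul_inv_smul (dual g) u, isSide_dual_smul] at hu
    rw [← smul_inv_smul (dual g) u, isTangent_dual_smul hγ]
    exact hv.2.2 _ hu

theorem IsCyclicEnumeration.smul (h : IsCyclicEnumeration γ v ℓ) (hγ : g • locus γ = locus γ') :
    IsCyclicEnumeration γ' (fun i => g • v i) (fun i => dual g • ℓ i) := by
  obtain ⟨hr, k, θ, hk, hθ, hper, hon⟩ := h
  refine ⟨?_, g * k, θ, ?_, hθ, hper, fun i => ?_⟩
  · ext u
    rw [Set.mem_ofPred_eq, ← smul_inv_smul (dual g) u, isSide_dual_smul]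
    change _ ↔ (dual g)⁻¹ • u ∈ {u | IsSide v u}
    rw [← hr]
    simp only [Set.mem_range, smul_inv_smul, eq_inv_smul_iff]
  · rw [mul_smul, hk, hγ]
  · rw [mul_smul, smul_onLine_dual_smul]
    exact hon i

theorem gridPoint_dual_smul (hγ : g • locus γ = locus γ') (i j : ZMod n) :
    gridPoint γ' (fun i => dual g • ℓ i) i j = g • gridPoint γ ℓ i j := by
  ext p
  rw [Set.mem_smul_set_iff_inv_smul_mem]
  simp only [gridPoint, Set.mem_ofPred_eq, onLine_dual_smul, ← hγ,
    Set.mem_smul_set_iff_inv_smul_mem]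

theorem gridP_dual_smul (hγ : g • locus γ = locus γ') (k : ZMod n) :
    gridP γ' (fun i => dual g • ℓ i) k = g • gridP γ ℓ k := by
  ext p
  rw [Set.mem_smul_set_iff_inv_smul_mem]
  simp only [gridP, Set.mem_ofPred_eq, gridPoint_dual_smul hγ, Set.mem_smul_set_iff_inv_smul_mem]

theorem gridQ_dual_smul (hγ : g • locus γ = locus γ') (k : ZMod n) :
    gridQ γ' (fun i => dual g • ℓ i) k = g • gridQ γ ℓ k := by
  ext p
  rw [Set.mem_smul_set_iff_inv_smul_mem]
  simp only [gridQ, Set.mem_ofPred_eq, gridPoint_dual_smul hγ, Set.mem_smul_set_iff_inv_smul_mem]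

theorem HasNoSymmetry.smul (h : HasNoSymmetry γ Γ v) (hγ : g • locus γ = locus γ')
    (hΓ : g • locus Γ = locus Γ') : HasNoSymmetry γ' Γ' (fun i => g • v i) := by
  intro k hkγ hkΓ hkv p
  have hrange : Set.range (fun i => g • v i) = g • Set.range v := by
    rw [← Set.image_smul, ← Set.range_comp]; rfl
  rw [hrange] at hkv
  rw [← hγ] at hkγ
  rw [← hΓ] at hkΓ
  have hfix := h (g⁻¹ * k * g) (by rw [mul_smul, mul_smul, hkγ, inv_smul_smul])
    (by rw [mul_smul, mul_smul, hkΓ, inv_smul_smul])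
    (by rw [mul_smul, mul_smul, hkv, inv_smul_smul]) (g⁻¹ • p)
  rw [mul_smul, mul_smul, smul_inv_smul] at hfix
  exact smul_left_cancel _ hfix

theorem IsPonceletPolygon.ne_add_one (hv : IsPonceletPolygon γ Γ v) (hn : 2 ≤ n) (i : ZMod n) :
    v i ≠ v (i + 1) := by
  have : Fact (1 < n) := ⟨hn⟩
  exact fun h => by simpa using hv.1 h

theorem IsPonceletPolygon.eq_or_eq_of_onLine (hv : IsPonceletPolygon γ Γ v) (hn : 2 ≤ n)
    (hΓ : Γ.IsSymm) (hdet : Γ.det ≠ 0) {p : Plane ℝ} {u : Line ℝ} {i : ZMod n}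
    (hi : OnLine (v i) u) (hi' : OnLine (v (i + 1)) u) (hpu : OnLine p u) (hp : p ∈ locus Γ) :
    p = v i ∨ p = v (i + 1) :=
  eq_or_eq_of_onLine_of_mem_locus hΓ hdet (hv.ne_add_one hn i) hi hi' hpu (hv.2.1 i) (hv.2.1 _) hp

theorem IsPonceletPolygon.range_eq (hv : IsPonceletPolygon γ Γ v) (hn : 2 ≤ n) (hΓ : Γ.IsSymm)
    (hdet : Γ.det ≠ 0) : Set.range v = {p | p ∈ locus Γ ∧ ∃ u, IsSide v u ∧ OnLine p u} := by
  ext p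
  constructor
  · rintro ⟨i, rfl⟩
    obtain ⟨u, hu⟩ := exists_onLine (v i) (v (i + 1))
    exact ⟨hv.2.1 i, u, ⟨i, hu⟩, hu.1⟩
  · rintro ⟨hp, u, ⟨i, hi, hi'⟩, hpu⟩
    rcases hv.eq_or_eq_of_onLine hn hΓ hdet hi hi' hpu hp with h | h
    · exact ⟨i, h.symm⟩
    · exact ⟨i + 1, h.symm⟩

theorem HasNoSymmetry.smul_eq_self (h : HasNoSymmetry γ Γ v) (hv : IsPonceletPolygon γ Γ v)
    (hn : 2 ≤ n) (hΓ : Γ.IsSymm) (hdet : Γ.det ≠ 0) (hgγ : g • locus γ = locus γ)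
    (hgΓ : g • locus Γ = locus Γ) (hside : ∀ u, IsSide v u → IsSide v (dual g • u))
    (p : Plane ℝ) : g • p = p := by
  have : NeZero n := ⟨by omega⟩
  have hsub : g • Set.range v ⊆ Set.range v := by
    rw [hv.range_eq hn hΓ hdet]
    rintro _ ⟨q, ⟨hq, u, hu, hqu⟩, rfl⟩
    refine ⟨?_, dual g • u, hside u hu, (smul_onLine_dual_smul g q u).2 hqu⟩
    rw [← hgΓ]
    exact Set.smul_mem_smul_set hq
  refine h g hgγ hgΓ (Set.eq_of_subset_of_ncard_le hsub ?_ (Set.finite_range v)) p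
  rw [← Set.image_smul, Set.ncard_image_of_injective _ (MulAction.injective g)]

end Transport

section EllipticIntegral

theorem one_sub_mul_sin_sq_pos {m : ℝ} (hm1 : m < 1) (x : ℝ) : 0 < 1 - m * Real.sin x ^ 2 := by
  rcases le_total 0 m with hm | hm
  · nlinarith [Real.sin_sq_le_one x]
  · nlinarith [sq_nonneg (Real.sin x)]

/-- The incomplete elliptic integral of the first kind with parameter `m`. Jacobi's amplitude is
its inverse function. -/
def ellipticF (m x : ℝ) : ℝ := ∫ t in (0 : ℝ)..x, (√(1 - m * Real.sin t ^ 2))⁻¹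

variable {m : ℝ}

theorem continuous_ellipticF_integrand (hm1 : m < 1) :
    Continuous fun t => (√(1 - m * Real.sin t ^ 2))⁻¹ :=
  Continuous.inv₀ (by fun_prop) fun t => (Real.sqrt_pos.2 (one_sub_mul_sin_sq_pos hm1 t)).ne'

theorem hasDerivAt_ellipticF (hm1 : m < 1) (x : ℝ) :
    HasDerivAt (ellipticF m) (√(1 - m * Real.sin x ^ 2))⁻¹ x :=
  (continuous_ellipticF_integrand hm1).integral_hasStrictDerivAt 0 x |>.hasDerivAt

theorem continuous_ellipticF (hm1 : m < 1) : Continuous (ellipticF m) :=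
  continuous_iff_continuousAt.2 fun x => (hasDerivAt_ellipticF hm1 x).continuousAt

theorem strictMono_ellipticF (hm1 : m < 1) : StrictMono (ellipticF m) :=
  strictMono_of_hasDerivAt_pos (hasDerivAt_ellipticF hm1) fun x =>
    inv_pos.2 (Real.sqrt_pos.2 (one_sub_mul_sin_sq_pos hm1 x))

theorem ellipticF_zero (m : ℝ) : ellipticF m 0 = 0 :=
  intervalIntegral.integral_same

theorem ellipticF_neg (m x : ℝ) : ellipticF m (-x) = -ellipticF m x := by
  have h := intervalIntegral.integral_comp_neg (a := 0) (b := x)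
    fun t => (√(1 - m * Real.sin t ^ 2))⁻¹
  simp only [Real.sin_neg, neg_sq, neg_zero] at h
  rw [ellipticF, ellipticF, h, intervalIntegral.integral_symm]

theorem ellipticF_add_pi (hm1 : m < 1) (x : ℝ) :
    ellipticF m (x + Real.pi) = ellipticF m x + ellipticF m Real.pi := by
  have hcont := continuous_ellipticF_integrand hm1
  have hper : Function.Periodic (fun t => (√(1 - m * Real.sin t ^ 2))⁻¹) Real.pi :=
    fun t => by simp only [Real.sin_add_pi, neg_sq]
  have h := hper.intervalIntegral_add_eq x 0
  rw [zero_add] at h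
  rw [ellipticF, ellipticF, ellipticF, ← h]
  exact (intervalIntegral.integral_add_adjacent_intervals (hcont.intervalIntegrable _ _)
    (hcont.intervalIntegrable _ _)).symm

theorem self_le_ellipticF (hm : 0 ≤ m) (hm1 : m < 1) {x : ℝ} (hx : 0 ≤ x) : x ≤ ellipticF m x := by
  have hone (t : ℝ) : 1 ≤ (√(1 - m * Real.sin t ^ 2))⁻¹ := by
    refine (one_le_inv₀ (Real.sqrt_pos.2 (one_sub_mul_sin_sq_pos hm1 t))).2 (Real.sqrt_le_one.2 ?_)
    linarith [mul_nonneg hm (sq_nonneg (Real.sin t))]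
  simpa [ellipticF] using intervalIntegral.integral_mono_on (f := fun _ => 1) hx
    (continuous_const.intervalIntegrable (μ := MeasureTheory.volume) 0 x)
    ((continuous_ellipticF_integrand hm1).intervalIntegrable 0 x) fun t _ => hone t

theorem surjective_ellipticF (hm : 0 ≤ m) (hm1 : m < 1) : Function.Surjective (ellipticF m) := by
  have htop : Filter.Tendsto (ellipticF m) Filter.atTop Filter.atTop :=
    Filter.tendsto_atTop_mono' _ ((Filter.eventually_ge_atTop (0 : ℝ)).mono fun _ hx =>
      self_le_ellipticF hm hm1 hx) Filter.tendsto_id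
  refine (continuous_ellipticF hm1).surjective htop ?_
  have hodd : ellipticF m = fun x => -ellipticF m (-x) := by
    ext x
    rw [ellipticF_neg, neg_neg]
  rw [hodd]
  exact Filter.tendsto_neg_atTop_atBot.comp (htop.comp Filter.tendsto_neg_atBot_atTop)

end EllipticIntegral

section JacobiFunctions

/-- `φ` is Jacobi's amplitude for the parameter `m` (the square of the modulus), and `K` is the
quarter period. -/
structure IsAmplitude (m K : ℝ) (φ : ℝ → ℝ) : Prop where
  m_nonneg : 0 ≤ m
  m_lt_one : m < 1
  K_pos : 0 < K
  strictMono : StrictMono φ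
  surjective : Function.Surjective φ
  neg : ∀ t, φ (-t) = -φ t
  add_two_K : ∀ t, φ (t + 2 * K) = φ t + Real.pi
  hasDerivAt : ∀ t, HasDerivAt φ (√(1 - m * Real.sin (φ t) ^ 2)) t

theorem exists_isAmplitude {m : ℝ} (hm : 0 ≤ m) (hm1 : m < 1) : ∃ K φ, IsAmplitude m K φ := by
  have hmono := strictMono_ellipticF hm1
  let e : ℝ ≃o ℝ := hmono.orderIsoOfSurjective _ (surjective_ellipticF hm hm1)
  have he (t : ℝ) : ellipticF m (e.symm t) = t := e.apply_symm_apply t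
  refine ⟨ellipticF m Real.pi / 2, e.symm, hm, hm1, ?_, e.symm.strictMono, e.symm.surjective,
    fun t => hmono.injective ?_, fun t => hmono.injective ?_, fun t => ?_⟩
  · exact half_pos (ellipticF_zero m ▸ hmono Real.pi_pos)
  · rw [he, ellipticF_neg, he]
  · rw [he, ellipticF_add_pi hm1, he]
    ring
  · have hpos := Real.sqrt_pos.2 (one_sub_mul_sin_sq_pos hm1 (e.symm t))
    simpa only [inv_inv] using (hasDerivAt_ellipticF hm1 _).of_local_left_inverse
      e.symm.continuous.continuousAt (inv_pos.2 hpos).ne' (Filter.Eventually.of_forall he)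

/-- The elliptic sine belonging to the amplitude `φ`. -/
def sn (φ : ℝ → ℝ) (t : ℝ) : ℝ := Real.sin (φ t)

/-- The elliptic cosine belonging to the amplitude `φ`. -/
def cn (φ : ℝ → ℝ) (t : ℝ) : ℝ := Real.cos (φ t)

/-- The delta amplitude, that is, the derivative of the amplitude `φ` with parameter `m`. -/
def dn (m : ℝ) (φ : ℝ → ℝ) (t : ℝ) : ℝ := √(1 - m * sn φ t ^ 2)

theorem sn_sq_add_cn_sq (φ : ℝ → ℝ) (t : ℝ) : sn φ t ^ 2 + cn φ t ^ 2 = 1 :=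
  Real.sin_sq_add_cos_sq _

namespace IsAmplitude

variable {m K : ℝ} {φ : ℝ → ℝ} (h : IsAmplitude m K φ)
include h

theorem map_zero : φ 0 = 0 := by
  have := h.neg 0
  rw [neg_zero] at this
  linarith

theorem map_K : φ K = Real.pi / 2 := by
  have := h.add_two_K (-K)
  rw [h.neg, show -K + 2 * K = K by ring] at this
  linarith

theorem add_int (t : ℝ) (j : ℤ) : φ (t + 2 * K * j) = φ t + j * Real.pi := by
  induction j with
  | zero => simp
  | succ j ih =>
    rw [show t + 2 * K * ((j + 1 : ℤ) : ℝ) = t + 2 * K * (j : ℤ) + 2 * K by push_cast; ring,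
      h.add_two_K, ih]
    push_cast
    ring
  | pred j ih =>
    have hstep := h.add_two_K (t + 2 * K * ((-j - 1 : ℤ) : ℝ))
    rw [show t + 2 * K * ((-j - 1 : ℤ) : ℝ) + 2 * K = t + 2 * K * ((-j : ℤ) : ℝ) by
      push_cast; ring, ih] at hstep
    push_cast at hstep ⊢
    linarith

theorem dn_pos (t : ℝ) : 0 < dn m φ t :=
  Real.sqrt_pos.2 (one_sub_mul_sin_sq_pos h.m_lt_one _)

theorem dn_sq (t : ℝ) : dn m φ t ^ 2 = 1 - m * sn φ t ^ 2 :=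
  Real.sq_sqrt (one_sub_mul_sin_sq_pos h.m_lt_one _).le

theorem sn_zero : sn φ 0 = 0 := by simp [sn, h.map_zero]

theorem cn_zero : cn φ 0 = 1 := by simp [cn, h.map_zero]

theorem dn_zero : dn m φ 0 = 1 := by simp [dn, h.sn_zero]

theorem sn_neg (t : ℝ) : sn φ (-t) = -sn φ t := by simp [sn, h.neg]

theorem cn_neg (t : ℝ) : cn φ (-t) = cn φ t := by simp [cn, h.neg]

theorem dn_neg (t : ℝ) : dn m φ (-t) = dn m φ t := by simp [dn, h.sn_neg]

theorem hasDerivAt_sn (t : ℝ) : HasDerivAt (sn φ) (cn φ t * dn m φ t) t :=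
  (h.hasDerivAt t).sin

theorem hasDerivAt_cn (t : ℝ) : HasDerivAt (cn φ) (-sn φ t * dn m φ t) t :=
  (h.hasDerivAt t).cos

theorem hasDerivAt_dn (t : ℝ) : HasDerivAt (dn m φ) (-(m * sn φ t * cn φ t)) t := by
  have hsq := (((h.hasDerivAt_sn t).fun_pow 2).const_mul m).const_sub 1
  refine (hsq.sqrt (one_sub_mul_sin_sq_pos h.m_lt_one _).ne').congr_deriv ?_
  change _ / (2 * dn m φ t) = _
  have := (h.dn_pos t).ne'
  field_simp
  ring

theorem one_sub_mul_sn_sq_mul_sn_sq_pos (s t : ℝ) : 0 < 1 - m * sn φ s ^ 2 * sn φ t ^ 2 := by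
  have hs : sn φ s ^ 2 ≤ 1 := Real.sin_sq_le_one _
  have ht : 0 < 1 - m * sn φ t ^ 2 := one_sub_mul_sin_sq_pos h.m_lt_one _
  nlinarith [mul_nonneg h.m_nonneg (sq_nonneg (sn φ t))]

-- `f` and the denominator of the addition theorems have the same logarithmic derivative along
-- `s + t = w`, so their quotient is constant there, and the denominator is `1` at `(0, w)`.
theorem eq_mul_of_hasDerivAt (w : ℝ) {f f' : ℝ → ℝ} (hf : ∀ t, HasDerivAt f (f' t) t)
    (hf' : ∀ t, f' t * (1 - m * sn φ t ^ 2 * sn φ (w - t) ^ 2) = f t * (2 * m * sn φ t *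
      sn φ (w - t) * (sn φ t * cn φ (w - t) * dn m φ (w - t) - cn φ t * dn m φ t * sn φ (w - t))))
    (x : ℝ) : f x = f 0 * (1 - m * sn φ x ^ 2 * sn φ (w - x) ^ 2) := by
  let D (t : ℝ) : ℝ := 1 - m * sn φ t ^ 2 * sn φ (w - t) ^ 2
  have hD0 (t : ℝ) : D t ≠ 0 := (h.one_sub_mul_sn_sq_mul_sn_sq_pos t (w - t)).ne'
  have hD (t : ℝ) : HasDerivAt D (2 * m * sn φ t * sn φ (w - t) *
      (sn φ t * cn φ (w - t) * dn m φ (w - t) - cn φ t * dn m φ t * sn φ (w - t))) t := by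
    refine (((((h.hasDerivAt_sn t).fun_pow 2).const_mul m).fun_mul
      (((h.hasDerivAt_sn (w - t)).comp_const_sub w t).fun_pow 2)).const_sub 1).congr_deriv ?_
    norm_num
    ring
  have hquot (t : ℝ) : HasDerivAt (fun t => f t / D t) 0 t :=
    ((hf t).fun_div (hD t) (hD0 t)).congr_deriv (by rw [hf' t, sub_self, zero_div])
  have hconst := is_const_of_deriv_eq_zero (fun t => (hquot t).differentiableAt)
    (fun t => (hquot t).deriv) x 0
  rwa [show D 0 = 1 by simp [D, h.sn_zero], div_one, div_eq_iff (hD0 x)] at hconst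

theorem sn_add (x y : ℝ) : sn φ (x + y) * (1 - m * sn φ x ^ 2 * sn φ y ^ 2) =
    sn φ x * cn φ y * dn m φ y + sn φ y * cn φ x * dn m φ x := by
  set w := x + y
  have key := h.eq_mul_of_hasDerivAt w (fun t =>
    ((h.hasDerivAt_sn t).fun_mul ((h.hasDerivAt_cn (w - t)).comp_const_sub w t)).fun_mul
      ((h.hasDerivAt_dn (w - t)).comp_const_sub w t) |>.fun_add
    ((((h.hasDerivAt_sn (w - t)).comp_const_sub w t).fun_mul (h.hasDerivAt_cn t)).fun_mul
      (h.hasDerivAt_dn t))) (fun t => ?_) x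
  · rw [show w - x = y by simp [w], sub_zero, h.sn_zero, h.cn_zero, h.dn_zero] at key
    linarith
  · have := sn_sq_add_cn_sq φ t
    have := sn_sq_add_cn_sq φ (w - t)
    have := h.dn_sq t
    have := h.dn_sq (w - t)
    grind

theorem cn_add (x y : ℝ) : cn φ (x + y) * (1 - m * sn φ x ^ 2 * sn φ y ^ 2) =
    cn φ x * cn φ y - sn φ x * sn φ y * dn m φ x * dn m φ y := by
  set w := x + y
  have key := h.eq_mul_of_hasDerivAt w (fun t =>
    ((h.hasDerivAt_cn t).fun_mul ((h.hasDerivAt_cn (w - t)).comp_const_sub w t)).fun_sub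
    ((((h.hasDerivAt_sn t).fun_mul ((h.hasDerivAt_sn (w - t)).comp_const_sub w t)).fun_mul
      (h.hasDerivAt_dn t)).fun_mul ((h.hasDerivAt_dn (w - t)).comp_const_sub w t)))
    (fun t => ?_) x
  · rw [show w - x = y by simp [w], sub_zero, h.sn_zero, h.cn_zero] at key
    linarith
  · have := sn_sq_add_cn_sq φ t
    have := sn_sq_add_cn_sq φ (w - t)
    have := h.dn_sq t
    have := h.dn_sq (w - t)
    grind

-- In the spherical triangle, `φ (x + y)` and `φ x` are two sides enclosing an angle of cosine
-- `dn y`, and `cn y` is the cosine of the third side.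
theorem law_of_cosines (x y : ℝ) :
    sn φ (x + y) * (sn φ x * dn m φ y) + cn φ (x + y) * cn φ x = cn φ y := by
  refine mul_right_cancel₀ (h.one_sub_mul_sn_sq_mul_sn_sq_pos x y).ne' ?_
  linear_combination sn φ x * dn m φ y * h.sn_add x y + cn φ x * h.cn_add x y +
    sn φ x ^ 2 * cn φ y * h.dn_sq y + cn φ y * sn_sq_add_cn_sq φ x

end IsAmplitude

end JacobiFunctions

section SimultaneousDiagonalization

variable {n : Type*} [Fintype n] [DecidableEq n] {A P : Matrix n n ℝ}

theorem exists_orthogonal_diagonalization (hA : A.IsHermitian) :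
    ∃ U : Matrix n n ℝ, Uᵀ * U = 1 ∧ Uᵀ * A * U = Matrix.diagonal hA.eigenvalues := by
  refine ⟨hA.eigenvectorUnitary, ?_, ?_⟩
  · simpa [Matrix.star_eq_conjTranspose] using Unitary.coe_star_mul_self hA.eigenvectorUnitary
  · simpa [Unitary.conjStarAlgAut_apply, Matrix.star_eq_conjTranspose, Function.comp_def] using
      hA.conjStarAlgAut_star_eigenvectorUnitary

theorem exists_transpose_mul_mul_eq_one (hP : P.PosDef) :
    ∃ B : Matrix n n ℝ, Bᵀ * P * B = 1 := by
  obtain ⟨U, -, hU⟩ := exists_orthogonal_diagonalization hP.isHermitian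
  let D := Matrix.diagonal fun i => (√(hP.isHermitian.eigenvalues i))⁻¹
  refine ⟨U * D, ?_⟩
  rw [Matrix.transpose_mul, show (Dᵀ * Uᵀ) * P * (U * D) = Dᵀ * (Uᵀ * P * U) * D by
    simp only [Matrix.mul_assoc], hU, Matrix.diagonal_transpose, Matrix.diagonal_mul_diagonal,
    Matrix.diagonal_mul_diagonal, ← Matrix.diagonal_one]
  congr 1
  ext i
  have hi := hP.eigenvalues_pos i
  have hsqrt := Real.sq_sqrt hi.le
  have := (Real.sqrt_pos.2 hi).ne'
  field_simp
  exact hsqrt.symm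

theorem exists_simultaneous_diagonalization (hP : P.PosDef) (hA : A.IsSymm) :
    ∃ (S : Matrix n n ℝ) (d : n → ℝ), Sᵀ * P * S = 1 ∧ Sᵀ * A * S = Matrix.diagonal d := by
  obtain ⟨B, hB⟩ := exists_transpose_mul_mul_eq_one hP
  have hBA : (Bᵀ * A * B).IsHermitian := by
    rw [Matrix.IsHermitian, Matrix.conjTranspose_eq_transpose_of_trivial, Matrix.transpose_mul,
      Matrix.transpose_mul, Matrix.transpose_transpose, hA.eq, Matrix.mul_assoc]
  obtain ⟨U, hU, hd⟩ := exists_orthogonal_diagonalization hBA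
  have hcomp (M : Matrix n n ℝ) : (B * U)ᵀ * M * (B * U) = Uᵀ * (Bᵀ * M * B) * U := by
    simp only [Matrix.transpose_mul, Matrix.mul_assoc]
  exact ⟨B * U, _, by rw [hcomp, hB, Matrix.mul_one, hU], (hcomp A).trans hd⟩

end SimultaneousDiagonalization

section SLemma

variable {M N : Mat ℝ}

theorem continuous_quad (M : Mat ℝ) : Continuous (quad M) := by
  unfold quad
  fun_prop

theorem quad_one (w : Fin 3 → ℝ) : quad 1 w = w ⬝ᵥ w := by
  rw [quad, Matrix.one_mulVec]

theorem quad_add (M N : Mat ℝ) (w : Fin 3 → ℝ) : quad (M + N) w = quad M w + quad N w := by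
  rw [quad, Matrix.add_mulVec, dotProduct_add, quad, quad]

theorem quad_sub (M N : Mat ℝ) (w : Fin 3 → ℝ) : quad (M - N) w = quad M w - quad N w := by
  rw [quad, Matrix.sub_mulVec, dotProduct_sub, quad, quad]

-- The quadratic form of `M` changes sign between `u` and `v`, hence it has zeros `u + t • v` with
-- `t` of either sign; for one of these signs the cross term of `N` helps.
theorem exists_quad_eq_zero_of_pos (hM : M.IsSymm) (hN : N.IsSymm) {u v : Fin 3 → ℝ}
    (hMu : quad M u < 0) (hMv : 0 < quad M v) (hNu : 0 < quad N u) (hNv : 0 < quad N v) :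
    ∃ w, w ≠ 0 ∧ quad M w = 0 ∧ 0 < quad N w := by
  wlog hB : 0 ≤ u ⬝ᵥ (N *ᵥ v) generalizing v
  · have hquad (L : Mat ℝ) : quad L (-v) = quad L v := by simpa using quad_smul L (-1) v
    exact this (v := -v) (by rwa [hquad]) (by rwa [hquad])
      (by simpa [Matrix.mulVec_neg] using (not_le.1 hB).le)
  have hline (L : Mat ℝ) (hL : L.IsSymm) (t : ℝ) :
      quad L (u + t • v) = quad L u + 2 * t * (u ⬝ᵥ (L *ᵥ v)) + t ^ 2 * quad L v := by
    simpa using quad_add_smul hL u v 1 t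
  obtain ⟨t, ht, hMt⟩ : ∃ t : ℝ, 0 ≤ t ∧ quad M (u + t • v) = 0 := by
    set b := u ⬝ᵥ (M *ᵥ v)
    set s := √(b ^ 2 - quad M u * quad M v)
    have hprod : 0 < -quad M u * quad M v := mul_pos (neg_pos.2 hMu) hMv
    have hs : s ^ 2 = b ^ 2 - quad M u * quad M v :=
      Real.sq_sqrt (by nlinarith [sq_nonneg b])
    refine ⟨(s - b) / quad M v, div_nonneg ?_ hMv.le, ?_⟩
    · exact sub_nonneg.2 (Real.le_sqrt_of_sq_le (by linarith))
    · rw [hline M hM]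
      field_simp
      linear_combination hs
  have hNt : 0 < quad N (u + t • v) := by
    rw [hline N hN]
    positivity
  refine ⟨_, fun h0 => ?_, hMt, hNt⟩
  rw [h0] at hNt
  simp [quad] at hNt

-- `μ` separates the values of `N / M` on `{M < 0}` from those on `{M > 0}`.
theorem exists_quad_le_mul_quad (hM : M.IsSymm) (hN : N.IsSymm) (hpos : ∃ w, 0 < quad M w)
    (hneg : ∃ w, quad M w < 0) (h : ∀ w, w ≠ 0 → quad M w ≤ 0 → quad N w < 0) :
    ∃ μ : ℝ, ∀ w, quad N w ≤ μ * quad M w := by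
  have hsep {u v : Fin 3 → ℝ} (hu : quad M u < 0) (hv : 0 < quad M v) :
      quad N v / quad M v ≤ quad N u / quad M u := by
    by_contra! hlt
    obtain ⟨μ, hμu, hμv⟩ := exists_between hlt
    rw [div_lt_iff_of_neg hu] at hμu
    rw [lt_div_iff₀ hv] at hμv
    have hquad (w : Fin 3 → ℝ) : quad (N - μ • M) w = quad N w - μ * quad M w := by
      rw [quad_sub, quad_smul_matrix]
    obtain ⟨w, hw, hMw, hNw⟩ := exists_quad_eq_zero_of_pos hM (hN.sub (hM.smul μ)) hu hv
      (by rw [hquad]; linarith) (by rw [hquad]; linarith)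
    rw [hquad, hMw] at hNw
    linarith [h w hw hMw.le]
  obtain ⟨u₀, hu₀⟩ := hneg
  obtain ⟨v₀, hv₀⟩ := hpos
  obtain ⟨μ, hμv, hμu⟩ := exists_between_of_forall_le
    (s := {r | ∃ v, 0 < quad M v ∧ quad N v / quad M v = r})
    (t := {r | ∃ u, quad M u < 0 ∧ quad N u / quad M u = r}) ⟨_, v₀, hv₀, rfl⟩ ⟨_, u₀, hu₀, rfl⟩
    (by rintro _ ⟨v, hv, rfl⟩ _ ⟨u, hu, rfl⟩; exact hsep hu hv)
  refine ⟨μ, fun w => ?_⟩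
  rcases lt_trichotomy (quad M w) 0 with hw | hw | hw
  · exact (le_div_iff_of_neg hw).1 (hμu ⟨w, hw, rfl⟩)
  · rw [hw, mul_zero]
    by_cases hw0 : w = 0
    · simp [hw0, quad]
    · exact (h w hw0 hw.le).le
  · exact (div_le_iff₀ hw).1 (hμv ⟨w, hw, rfl⟩)

theorem exists_quad_add_smul_one_neg (hneg : ∃ w, quad M w < 0)
    (h : ∀ w, w ≠ 0 → quad M w ≤ 0 → quad N w < 0) :
    ∃ ε : ℝ, 0 < ε ∧ ∀ w, w ≠ 0 → quad M w ≤ 0 → quad (N + ε • 1) w < 0 := by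
  have hself {w : Fin 3 → ℝ} (hw : w ≠ 0) : 0 < w ⬝ᵥ w := by
    simpa using Matrix.dotProduct_star_self_pos_iff.2 hw
  let S : Set (Fin 3 → ℝ) := Metric.sphere 0 1 ∩ {w | quad M w ≤ 0}
  have hSne {w : Fin 3 → ℝ} (hw : w ∈ S) : w ≠ 0 := ne_zero_of_mem_unit_sphere ⟨w, hw.1⟩
  have hscale {w : Fin 3 → ℝ} (hw : w ≠ 0) (hMw : quad M w ≤ 0) : ‖w‖⁻¹ • w ∈ S := by
    refine ⟨by simp [norm_smul, hw], ?_⟩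
    rw [Set.mem_ofPred_eq, quad_smul]
    exact mul_nonpos_of_nonneg_of_nonpos (sq_nonneg _) hMw
  obtain ⟨w₀, hw₀⟩ := hneg
  have hw₀' : w₀ ≠ 0 := by
    rintro rfl
    simp [quad] at hw₀
  have hS : IsCompact S :=
    (isCompact_sphere 0 1).inter_right (isClosed_le (continuous_quad M) continuous_const)
  obtain ⟨p, hpS, hmax⟩ := hS.exists_isMaxOn ⟨_, hscale hw₀' hw₀.le⟩
    (f := fun w => quad N w / w ⬝ᵥ w) ((continuous_quad N).continuousOn.div
      (by fun_prop) fun w hw => (hself (hSne hw)).ne')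
  have hp : quad N p / p ⬝ᵥ p < 0 :=
    div_neg_of_neg_of_pos (h p (hSne hpS) hpS.2) (hself (hSne hpS))
  refine ⟨-(quad N p / p ⬝ᵥ p) / 2, by linarith, fun w hw hMw => ?_⟩
  have hle : quad N w / w ⬝ᵥ w ≤ quad N p / p ⬝ᵥ p := by
    have hsw : quad N (‖w‖⁻¹ • w) / (‖w‖⁻¹ • w) ⬝ᵥ (‖w‖⁻¹ • w) ≤ _ := hmax (hscale hw hMw)
    have hnorm : (‖w‖⁻¹) ^ 2 ≠ 0 := by simpa using hw
    rwa [← quad_one, quad_smul, quad_smul, mul_div_mul_left _ _ hnorm,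
      quad_one] at hsw
  rw [div_le_iff₀ (hself hw)] at hle
  rw [quad_add, quad_smul_matrix, quad_one]
  nlinarith [mul_neg_of_neg_of_pos hp (hself hw)]

theorem exists_posDef_smul_sub (hM : M.IsSymm) (hN : N.IsSymm) (hpos : ∃ w, 0 < quad M w)
    (hneg : ∃ w, quad M w < 0) (h : ∀ w, w ≠ 0 → quad M w ≤ 0 → quad N w < 0) :
    ∃ μ : ℝ, (μ • M - N).PosDef := by
  obtain ⟨ε, hε, hNε⟩ := exists_quad_add_smul_one_neg hneg h
  have hsymm : (N + ε • 1 : Mat ℝ).IsSymm := hN.add (Matrix.isSymm_one.smul ε)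
  obtain ⟨μ, hμ⟩ := exists_quad_le_mul_quad hM hsymm hpos hneg hNε
  refine ⟨μ, .of_dotProduct_mulVec_pos ((hM.smul μ).sub hN) fun w hw => ?_⟩
  have hw' : 0 < w ⬝ᵥ w := by simpa using Matrix.dotProduct_star_self_pos_iff.2 hw
  have hle := hμ w
  rw [quad_add, quad_smul_matrix, quad_one] at hle
  rw [star_trivial]
  change 0 < quad (μ • M - N) w
  rw [quad_sub, quad_smul_matrix]
  nlinarith [mul_pos hε hw']

end SLemma

section NormalForm

theorem quad_diagonal {K : Type*} [Field K] (d w : Fin 3 → K) :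
    quad (Matrix.diagonal d) w = ∑ i, d i * w i ^ 2 := by
  simp only [quad, Matrix.mulVec_diagonal, dotProduct]
  exact Finset.sum_congr rfl fun i _ => by ring

theorem transpose_mul_mul_submatrix_mul_diagonal {n R : Type*} [Fintype n] [DecidableEq n]
    [CommRing R] {S A : Matrix n n R} {a : n → R} (h : Sᵀ * A * S = Matrix.diagonal a)
    (σ : Equiv.Perm n) (c : n → R) :
    (S.submatrix id σ * Matrix.diagonal c)ᵀ * A * (S.submatrix id σ * Matrix.diagonal c) =
      Matrix.diagonal fun i => c i ^ 2 * a (σ i) := by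
  have hσ : (S.submatrix id σ)ᵀ * A * S.submatrix id σ = Matrix.diagonal (a ∘ σ) := by
    rw [← Matrix.submatrix_diagonal_equiv, ← h]
    rfl
  rw [Matrix.transpose_mul, Matrix.diagonal_transpose, Matrix.mul_assoc, Matrix.mul_assoc,
    ← Matrix.mul_assoc A, ← Matrix.mul_assoc (S.submatrix id σ)ᵀ, ← Matrix.mul_assoc _ A, hσ,
    Matrix.diagonal_mul_diagonal, Matrix.diagonal_mul_diagonal]
  congr 1
  ext i
  rw [Function.comp_apply]
  ring

theorem exists_perm_pos_pos_neg {d : Fin 3 → ℝ} (hprod : ∏ i, d i < 0) (hpos : ∃ i, 0 < d i)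
    (r : Fin 3 → ℝ) : ∃ σ : Equiv.Perm (Fin 3),
      0 < d (σ 0) ∧ 0 < d (σ 1) ∧ d (σ 2) < 0 ∧ r (σ 1) ≤ r (σ 0) := by
  obtain ⟨τ, h0, h1, h2⟩ : ∃ τ : Equiv.Perm (Fin 3),
      0 < d (τ 0) ∧ 0 < d (τ 1) ∧ d (τ 2) < 0 := by
    obtain ⟨k, hk⟩ : ∃ k, d k < 0 := by
      by_contra! hd
      exact hprod.not_ge (Finset.prod_nonneg fun i _ => hd i)
    let τ := Equiv.swap k 2
    have hτ2 : d (τ 2) < 0 := by rwa [Equiv.swap_apply_right]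
    rw [← Equiv.prod_comp τ, Fin.prod_univ_three] at hprod
    rcases pos_and_pos_or_neg_and_neg_of_mul_pos (pos_of_mul_neg_left hprod hτ2.le) with h | h
    · exact ⟨τ, h.1, h.2, hτ2⟩
    · obtain ⟨i, hi⟩ := hpos
      obtain ⟨j, rfl⟩ := τ.surjective i
      fin_cases j
      exacts [(hi.not_gt h.1).elim, (hi.not_gt h.2).elim, (hi.not_gt hτ2).elim]
  rcases le_total (r (τ 1)) (r (τ 0)) with hr | hr
  · exact ⟨τ, h0, h1, h2, hr⟩
  · exact ⟨τ * Equiv.swap 0 1, by simpa using h1, by simpa using h0,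
      by simpa [Equiv.swap_apply_of_ne_of_ne] using h2, by simpa using hr⟩

theorem quad_axisConic (a b : ℝ) (w : Fin 3 → ℝ) :
    quad (axisConic a b) w = w 0 ^ 2 / a + w 1 ^ 2 / b - w 2 ^ 2 := by
  rw [axisConic, quad_diagonal, Fin.sum_univ_three]
  simp only [Matrix.cons_val]
  ring

theorem isSymm_axisConic (a b : ℝ) : (axisConic a b).IsSymm := Matrix.isSymm_diagonal _

variable {M N : Mat ℝ}

theorem exists_signature_normalization {S : Mat ℝ} {d e : Fin 3 → ℝ}
    (hSM : Sᵀ * M * S = Matrix.diagonal d) (hSN : Sᵀ * N * S = Matrix.diagonal e)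
    (hprod : ∏ i, d i < 0) (hpos : ∃ i, 0 < d i) :
    ∃ (G : Mat ℝ) (x y z : ℝ), y ≤ x ∧ Gᵀ * M * G = Matrix.diagonal ![1, 1, -1] ∧
      Gᵀ * N * G = Matrix.diagonal ![x, y, z] := by
  obtain ⟨σ, h0, h1, h2, hr⟩ := exists_perm_pos_pos_neg hprod hpos fun i => e i / |d i|
  have hscale (t u : ℝ) : (√|t|)⁻¹ ^ 2 * u = u / |t| := by
    rw [inv_pow, Real.sq_sqrt (abs_nonneg t), inv_mul_eq_div]
  have hscale_pos {t : ℝ} (ht : 0 < t) : (√|t|)⁻¹ ^ 2 * t = 1 := by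
    rw [hscale, abs_of_pos ht, div_self ht.ne']
  have hscale_neg {t : ℝ} (ht : t < 0) : (√|t|)⁻¹ ^ 2 * t = -1 := by
    rw [hscale, abs_of_neg ht, div_neg, div_self ht.ne]
  refine ⟨S.submatrix id σ * Matrix.diagonal fun i => (√|d (σ i)|)⁻¹, _, _,
    e (σ 2) / |d (σ 2)|, hr, ?_, ?_⟩
  · rw [transpose_mul_mul_submatrix_mul_diagonal hSM]
    congr 1
    ext i
    fin_cases i
    exacts [hscale_pos h0, hscale_pos h1, hscale_neg h2]
  · rw [transpose_mul_mul_submatrix_mul_diagonal hSN]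
    congr 1
    ext i
    fin_cases i <;> exact hscale _ _

theorem exists_transpose_mul_mul_eq_diagonal (hM : M.IsSymm) (hN : N.IsSymm)
    (hMpos : ∃ w, 0 < quad M w) (hMdet : M.det < 0)
    (h : ∀ w, w ≠ 0 → quad M w ≤ 0 → quad N w < 0) :
    ∃ (G : Mat ℝ) (x y z : ℝ), y ≤ x ∧ Gᵀ * M * G = Matrix.diagonal ![1, 1, -1] ∧
      Gᵀ * N * G = Matrix.diagonal ![x, y, z] := by
  have hMneg : ∃ w, quad M w < 0 := by
    by_contra! hw
    exact (Matrix.PosSemidef.of_dotProduct_mulVec_nonneg hM fun w =>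
      star_trivial w ▸ hw w).det_nonneg.not_gt hMdet
  obtain ⟨μ, hμ⟩ := exists_posDef_smul_sub hM hN hMpos hMneg h
  obtain ⟨S, d, hS, hSM⟩ := exists_simultaneous_diagonalization hμ hM
  have hSN : Sᵀ * N * S = Matrix.diagonal fun i => μ * d i - 1 := by
    have hN' : N = μ • M - (μ • M - N) := by abel
    rw [hN', Matrix.mul_sub, Matrix.sub_mul, hS, Matrix.mul_smul, Matrix.smul_mul, hSM,
      ← Matrix.diagonal_smul, ← Matrix.diagonal_one, Matrix.diagonal_sub]
    rfl
  have hSdet : S.det ≠ 0 := fun h0 => by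
    simpa [Matrix.det_mul, h0] using congrArg Matrix.det hS
  have hprod : ∏ i, d i < 0 := by
    rw [← Matrix.det_diagonal, ← hSM, Matrix.det_mul, Matrix.det_mul, Matrix.det_transpose]
    nlinarith [mul_pos_of_neg_of_neg hMdet (neg_lt_zero.2 (pow_pos (abs_pos.2 hSdet) 2)),
      sq_abs S.det]
  have hdpos : ∃ i, 0 < d i := by
    obtain ⟨v, hv⟩ := hMpos
    by_contra! hd
    have hSv : S *ᵥ (S⁻¹ *ᵥ v) = v := by
      rw [Matrix.mulVec_mulVec, Matrix.mul_nonsing_inv _ hSdet.isUnit, Matrix.one_mulVec]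
    rw [← hSv, quad_mulVec, hSM, quad_diagonal] at hv
    exact hv.not_ge (Finset.sum_nonpos fun i _ =>
      mul_nonpos_of_nonpos_of_nonneg (hd i) (sq_nonneg _))
  exact exists_signature_normalization hSM hSN hprod hdpos

theorem signs_of_forall_quad_diagonal_neg {x y z : ℝ} (hdet : x * y * z < 0)
    (hpos : ∃ w, 0 < quad (Matrix.diagonal ![x, y, z]) w)
    (hneg : ∀ w, w ≠ 0 → w 0 ^ 2 + w 1 ^ 2 ≤ w 2 ^ 2 → quad (Matrix.diagonal ![x, y, z]) w < 0) :
    0 < x ∧ 0 < y ∧ z < 0 ∧ x < -z := by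
  simp only [quad_diagonal, Fin.sum_univ_three, Matrix.cons_val] at hpos hneg
  have hz : z < 0 := by simpa using hneg ![0, 0, 1] (by simp) (by simp)
  have hxz : x < -z := by
    have := hneg ![1, 0, 1] (by simp) (by simp)
    simp only [Matrix.cons_val] at this
    linarith
  obtain ⟨hx, hy⟩ : 0 < x ∧ 0 < y := by
    have hxy : 0 < x * y := pos_of_mul_neg_left hdet hz.le
    refine (pos_and_pos_or_neg_and_neg_of_mul_pos hxy).resolve_right fun ⟨hx, hy⟩ => ?_
    obtain ⟨w, hw⟩ := hpos
    linarith [mul_nonpos_of_nonpos_of_nonneg hx.le (sq_nonneg (w 0)),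
      mul_nonpos_of_nonpos_of_nonneg hy.le (sq_nonneg (w 1)),
      mul_nonpos_of_nonpos_of_nonneg hz.le (sq_nonneg (w 2))]
  exact ⟨hx, hy, hz, hxz⟩

theorem exists_conicImage_eq_of_pos (hM : M.IsSymm) (hN : N.IsSymm)
    (hMpos : ∃ w, 0 < quad M w) (hMdet : M.det < 0) (hNpos : ∃ w, 0 < quad N w) (hNdet : N.det < 0)
    (h : ∀ w, w ≠ 0 → quad M w ≤ 0 → quad N w < 0) :
    ∃ (g : GL (Fin 3) ℝ) (κ A B : ℝ), 0 < κ ∧ 1 < A ∧ A ≤ B ∧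
      conicImage g M = axisConic 1 1 ∧ conicImage g N = κ • axisConic A B := by
  obtain ⟨G, x, y, z, hyx, hGM, hGN⟩ := exists_transpose_mul_mul_eq_diagonal hM hN hMpos hMdet h
  have hGdet : G.det ≠ 0 := fun h0 => by
    simpa [Matrix.det_mul, h0, Fin.prod_univ_three] using congrArg Matrix.det hGM
  have hGunit : IsUnit G := (Matrix.isUnit_iff_isUnit_det _).2 hGdet.isUnit
  have hdet : x * y * z < 0 := by
    have := congrArg Matrix.det hGN
    rw [Matrix.det_mul, Matrix.det_mul, Matrix.det_transpose, Matrix.det_diagonal,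
      Fin.prod_univ_three, mul_right_comm, ← sq] at this
    exact this ▸ mul_neg_of_pos_of_neg (by positivity) hNdet
  obtain ⟨hx, hy, hz, hxz⟩ := signs_of_forall_quad_diagonal_neg hdet
    (by
      obtain ⟨v, hv⟩ := hNpos
      obtain ⟨w, rfl⟩ := Matrix.mulVec_surjective_iff_isUnit.2 hGunit v
      exact ⟨w, by rwa [← hGN, ← quad_mulVec]⟩)
    fun w hw hMw => by
      rw [← hGN, ← quad_mulVec]
      refine h _ (fun h0 => hw (Matrix.mulVec_injective_of_isUnit hGunit (by simpa using h0))) ?_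
      rw [quad_mulVec, hGM, quad_diagonal, Fin.sum_univ_three]
      simpa using hMw
  refine ⟨hGunit.unit⁻¹, -z, -z / x, -z / y, neg_pos.2 hz, (one_lt_div hx).2 hxz,
    div_le_div_of_nonneg_left (neg_pos.2 hz).le hy hyx, ?_, ?_⟩
  · rw [conicImage_inv, IsUnit.unit_spec, hGM, axisConic]
    simp
  · rw [conicImage_inv, IsUnit.unit_spec, hGN, axisConic, ← Matrix.diagonal_smul]
    congr 1
    ext i
    fin_cases i <;> simp [← mul_div_assoc, mul_div_cancel_left₀ _ hz.ne]

theorem IsEllipse.exists_smul (hM : IsEllipse M) :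
    ∃ s : ℝ, s ≠ 0 ∧ (∃ w, 0 < quad (s • M) w) ∧ (s • M).det < 0 ∧
      ∀ w, quad (s • M) w < 0 ↔ (M 0 0 + M 1 1) * quad M w < 0 := by
  obtain ⟨-, hminor, hdet⟩ := hM
  have hs : M 0 0 + M 1 1 ≠ 0 := fun h0 => by simp [h0] at hdet
  refine ⟨M 0 0 + M 1 1, hs, ⟨![1, 0, 0], ?_⟩, ?_, fun w => by rw [quad_smul_matrix]⟩
  · have hquad : quad M ![1, 0, 0] = M 0 0 := by
      simp [quad, Matrix.mulVec, dotProduct, Fin.sum_univ_three]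
    rw [quad_smul_matrix, hquad]
    nlinarith [sq_nonneg (M 0 0), sq_nonneg (M 0 1)]
  · rw [Matrix.det_smul, Fintype.card_fin, pow_succ, mul_assoc]
    exact mul_neg_of_pos_of_neg (by positivity) hdet

theorem conicImage_smul (g : GL (Fin 3) ℝ) (s : ℝ) (M : Mat ℝ) :
    conicImage g (s • M) = s • conicImage g M := by
  rw [conicImage, conicImage, Matrix.mul_smul, Matrix.smul_mul]

theorem inside_mk {w : Fin 3 → ℝ} (hw : w ≠ 0) :
    Inside M (Projectivization.mk ℝ w hw) ↔ (M 0 0 + M 1 1) * quad M w < 0 := by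
  obtain ⟨a, ha⟩ := Projectivization.exists_smul_eq_mk_rep ℝ w hw
  have ha2 : 0 < (a : ℝ) ^ 2 := by
    have := a.ne_zero
    positivity
  rw [Inside, ← ha, Units.smul_def, quad_smul, mul_left_comm, mul_neg_iff]
  simp [ha2, ha2.not_gt]

theorem exists_normalForm (hM : IsEllipse M) (hN : IsEllipse N) (h : Nested M N) :
    ∃ (g : GL (Fin 3) ℝ) (s s' A B : ℝ), s ≠ 0 ∧ s' ≠ 0 ∧ 1 < A ∧ A ≤ B ∧
      conicImage g M = s • axisConic 1 1 ∧ conicImage g N = s' • axisConic A B := by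
  obtain ⟨s, hs, hMpos, hMdet, hMneg⟩ := hM.exists_smul
  obtain ⟨s', hs', hNpos, hNdet, hNneg⟩ := hN.exists_smul
  have hcone (w : Fin 3 → ℝ) (hw : w ≠ 0) (hle : quad (s • M) w ≤ 0) : quad (s' • N) w < 0 := by
    rw [hNneg, ← inside_mk hw]
    refine h _ (hle.eq_or_lt.imp (fun h0 => ?_) fun hlt => (inside_mk hw).2 ((hMneg w).1 hlt))
    rw [quad_smul_matrix] at h0
    exact (mk_mem_locus hw).2 ((mul_eq_zero.1 h0).resolve_left hs)
  obtain ⟨g, κ, A, B, hκ, hA, hAB, hgM, hgN⟩ := exists_conicImage_eq_of_pos (hM.1.smul s)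
    (hN.1.smul s') hMpos hMdet hNpos hNdet hcone
  rw [conicImage_smul] at hgM hgN
  refine ⟨g, s⁻¹, s'⁻¹ * κ, A, B, inv_ne_zero hs, mul_ne_zero (inv_ne_zero hs') hκ.ne', hA, hAB,
    ?_, ?_⟩
  · rw [← hgM, inv_smul_smul₀ hs]
  · rw [mul_smul, ← hgN, inv_smul_smul₀ hs']

end NormalForm

section TangentLines

namespace IsAmplitude

variable {m K : ℝ} {φ : ℝ → ℝ} (h : IsAmplitude m K φ)
include h

theorem add_four_K (t : ℝ) (j : ℤ) : φ (t + 4 * K * j) = φ t + j * (2 * Real.pi) := by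
  rw [show t + 4 * K * j = t + 2 * K * (2 * j : ℤ) by push_cast; ring, h.add_int]
  push_cast
  ring

theorem sn_add_four_K (t : ℝ) (j : ℤ) : sn φ (t + 4 * K * j) = sn φ t := by
  rw [sn, h.add_four_K, Real.sin_add_int_mul_two_pi, sn]

theorem cn_add_four_K (t : ℝ) (j : ℤ) : cn φ (t + 4 * K * j) = cn φ t := by
  rw [cn, h.add_four_K, Real.cos_add_int_mul_two_pi, cn]

theorem sn_two_K_sub (t : ℝ) : sn φ (2 * K - t) = sn φ t := by
  rw [sn, show 2 * K - t = -t + 2 * K by ring, h.add_two_K, h.neg, Real.sin_add_pi, Real.sin_neg,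
    neg_neg, sn]

theorem cn_two_K_sub (t : ℝ) : cn φ (2 * K - t) = -cn φ t := by
  rw [cn, show 2 * K - t = -t + 2 * K by ring, h.add_two_K, h.neg, Real.cos_add_pi, Real.cos_neg,
    cn]

theorem exists_eq_of_sn_eq_cn_eq {x y : ℝ} (hs : sn φ x = sn φ y) (hc : cn φ x = cn φ y) :
    ∃ j : ℤ, x = y + 4 * K * j := by
  obtain ⟨j, hj⟩ := Real.Angle.angle_eq_iff_two_pi_dvd_sub.1 (Real.Angle.cos_sin_inj hc hs)
  refine ⟨j, h.strictMono.injective ?_⟩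
  rw [h.add_four_K]
  linarith

theorem exists_eq_of_sn_sq_eq {x y : ℝ} (hs : sn φ x ^ 2 = sn φ y ^ 2) :
    ∃ j : ℤ, x = y + 2 * K * j ∨ x = -y + 2 * K * j := by
  have hcos : Real.cos (2 * φ x) = Real.cos (2 * φ y) := by
    rw [Real.cos_two_mul, Real.cos_two_mul, Real.cos_sq', Real.cos_sq']
    change 2 * (1 - sn φ x ^ 2) - 1 = 2 * (1 - sn φ y ^ 2) - 1
    rw [hs]
  obtain ⟨j, hj | hj⟩ := Real.cos_eq_cos_iff.1 hcos
  · refine ⟨-j, Or.inl (h.strictMono.injective ?_)⟩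
    rw [h.add_int]
    push_cast
    linarith
  · refine ⟨j, Or.inr (h.strictMono.injective ?_)⟩
    rw [h.add_int, h.neg]
    linarith

theorem sn_eq_zero_iff {x : ℝ} : sn φ x = 0 ↔ ∃ j : ℤ, x = 2 * K * j := by
  constructor
  · intro hs
    obtain ⟨j, hj⟩ := h.exists_eq_of_sn_sq_eq (x := x) (y := 0) (by rw [hs, h.sn_zero])
    exact ⟨j, by simpa using hj⟩
  · rintro ⟨j, rfl⟩
    rw [sn, ← zero_add (2 * K * j), h.add_int, h.map_zero, zero_add, Real.sin_int_mul_pi]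

theorem exists_eq_of_cn_eq_zero {x : ℝ} (hc : cn φ x = 0) : ∃ j : ℤ, x = K + 2 * K * j := by
  have hsx := sn_sq_add_cn_sq φ x
  have hsK : sn φ K = 1 := by rw [sn, h.map_K, Real.sin_pi_div_two]
  obtain ⟨j, hj | hj⟩ := h.exists_eq_of_sn_sq_eq (x := x) (y := K) (by
    rw [hsK]
    rw [hc] at hsx
    linarith)
  · exact ⟨j, hj⟩
  · exact ⟨j - 1, by rw [hj]; push_cast; ring⟩

theorem exists_sn_cn {x y : ℝ} (hxy : x ^ 2 + y ^ 2 = 1) : ∃ t, sn φ t = x ∧ cn φ t = y := by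
  have hnorm : ‖(⟨y, x⟩ : ℂ)‖ = 1 := by
    rw [Complex.norm_def, Real.sqrt_eq_one, Complex.normSq_mk]
    linarith
  obtain ⟨t, ht⟩ := h.surjective (Complex.arg ⟨y, x⟩)
  refine ⟨t, ?_, ?_⟩
  · simpa [sn, ht, hnorm] using Complex.norm_mul_sin_arg ⟨y, x⟩
  · simpa [cn, ht, hnorm] using Complex.norm_mul_cos_arg ⟨y, x⟩

end IsAmplitude

/-- The tangent line `x sn t + y cn t = 1` of the unit circle, so that the sides of a Poncelet
polygon are obtained from each other by translations of the parameter `t`. -/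
def tangentLine (φ : ℝ → ℝ) (t : ℝ) : Line ℝ :=
  Projectivization.mk ℝ ![sn φ t, cn φ t, -1] (fun h => by simpa using congrFun h 2)

theorem quad_adjugate_diagonal {F : Type*} [Field F] (a b c : F) (w : Fin 3 → F) :
    quad (Matrix.diagonal ![a, b, c]).adjugate w =
      b * c * w 0 ^ 2 + a * c * w 1 ^ 2 + a * b * w 2 ^ 2 := by
  simp only [Matrix.adjugate_fin_three, quad, dotProduct, Matrix.mulVec, Fin.sum_univ_three,
    Matrix.of_apply, Matrix.diagonal_apply, Fin.isValue, Matrix.cons_val]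
  simp
  ring

theorem det_axisConic (a b : ℝ) : (axisConic a b).det = -(1 / a * (1 / b)) := by
  simp [axisConic, Matrix.det_diagonal, Fin.prod_univ_three]

theorem isTangent_axisConic_one_one_mk_iff {u : Fin 3 → ℝ} (hu : u ≠ 0) :
    IsTangent (axisConic 1 1) (Projectivization.mk ℝ u hu) ↔ u 0 ^ 2 + u 1 ^ 2 = u 2 ^ 2 := by
  rw [isTangent_mk_iff (isSymm_axisConic 1 1) (by simp [det_axisConic]), axisConic,
    quad_adjugate_diagonal]
  constructor <;> intro h <;> linarith

theorem ne_zero_of_sq_add_sq_eq_sq {w : Fin 3 → ℝ} (hw : w ≠ 0)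
    (h : w 0 ^ 2 + w 1 ^ 2 = w 2 ^ 2) : w 2 ≠ 0 := by
  intro h2
  rw [h2, zero_pow two_ne_zero, sq, sq, mul_self_add_mul_self_eq_zero] at h
  refine hw (funext fun i => ?_)
  fin_cases i
  exacts [h.1, h.2, h2]

theorem one_lt_of_sub_one_eq {m A B : ℝ} (hm1 : m < 1) (hA : 1 < A)
    (hAB : A - 1 = (1 - m) * (B - 1)) : 1 < B := by
  have hpos : 0 < (1 - m) * (B - 1) := hAB ▸ sub_pos.2 hA
  exact sub_pos.1 (pos_of_mul_pos_right hpos (sub_pos.2 hm1).le)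

namespace IsAmplitude

variable {m K : ℝ} {φ : ℝ → ℝ} (h : IsAmplitude m K φ)
include h

theorem tangentLine_eq_iff {x y : ℝ} :
    tangentLine φ x = tangentLine φ y ↔ ∃ j : ℤ, x = y + 4 * K * j := by
  constructor
  · intro hxy
    obtain ⟨a, ha⟩ := (Projectivization.mk_eq_mk_iff' ℝ _ _ _ _).1 hxy
    obtain rfl : a = 1 := by simpa using congrFun ha 2
    rw [one_smul] at ha
    exact h.exists_eq_of_sn_eq_cn_eq (congrFun ha 0).symm (congrFun ha 1).symm
  · rintro ⟨j, rfl⟩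
    simp only [tangentLine, h.sn_add_four_K, h.cn_add_four_K]

theorem exists_eq_tangentLine {u : Line ℝ} (hu : IsTangent (axisConic 1 1) u) :
    ∃ t, u = tangentLine φ t := by
  induction u using Projectivization.ind with | h u hu0 =>
  rw [isTangent_axisConic_one_one_mk_iff] at hu
  have hu2 := ne_zero_of_sq_add_sq_eq_sq hu0 hu
  obtain ⟨t, hs, hc⟩ := h.exists_sn_cn (x := -(u 0 / u 2)) (y := -(u 1 / u 2)) (by
    field_simp
    exact hu)
  refine ⟨t, mk_eq_mk_of_smul_eq (a := -u 2) _ _ ?_⟩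
  ext i
  fin_cases i <;> simp [hs, hc, mul_div_cancel₀ _ hu2]

theorem point_ne_zero (x y : ℝ) : (![sn φ x * dn m φ y, cn φ x, cn φ y] : Fin 3 → ℝ) ≠ 0 := by
  intro h0
  have hs : sn φ x = 0 := by simpa [(h.dn_pos y).ne'] using congrFun h0 0
  have hc : cn φ x = 0 := by simpa using congrFun h0 1
  simpa [hs, hc] using sn_sq_add_cn_sq φ x

/-- The intersection point of the tangent lines with the parameters `x + y` and `x - y`; the
tangency point of the line with the parameter `x` if `y = 0`. -/
def point (x y : ℝ) : Plane ℝ := Projectivization.mk ℝ _ (h.point_ne_zero x y)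

theorem onLine_point_add (x y : ℝ) : OnLine (h.point x y) (tangentLine φ (x + y)) := by
  rw [point, tangentLine, onLine_mk]
  simpa [dotProduct, Fin.sum_univ_three, ← sub_eq_add_neg] using
    sub_eq_zero.2 (h.law_of_cosines x y)

theorem onLine_point_sub (x y : ℝ) : OnLine (h.point x y) (tangentLine φ (x - y)) := by
  have hsymm : h.point x y = h.point x (-y) := by
    simp only [point, h.dn_neg, h.cn_neg]
  rw [hsymm, sub_eq_add_neg]
  exact h.onLine_point_add x (-y)

theorem eq_point {x y : ℝ} {p : Plane ℝ} (hne : tangentLine φ x ≠ tangentLine φ y)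
    (hx : OnLine p (tangentLine φ x)) (hy : OnLine p (tangentLine φ y)) :
    p = h.point ((x + y) / 2) ((x - y) / 2) := by
  refine eq_of_onLine_of_onLine hne hx hy ?_ ?_
  · convert h.onLine_point_add ((x + y) / 2) ((x - y) / 2) using 2
    ring
  · convert h.onLine_point_sub ((x + y) / 2) ((x - y) / 2) using 2
    ring

theorem eq_point_zero {t : ℝ} {p : Plane ℝ} (hp : OnLine p (tangentLine φ t))
    (hp' : p ∈ locus (axisConic 1 1)) : p = h.point t 0 := by
  have htangent : IsTangent (axisConic 1 1) (tangentLine φ t) := by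
    rw [tangentLine, isTangent_axisConic_one_one_mk_iff]
    simpa using sn_sq_add_cn_sq φ t
  refine htangent.unique ⟨hp, hp'⟩ ⟨by simpa using h.onLine_point_add t 0, ?_⟩
  rw [point, mk_mem_locus, quad_axisConic]
  simp [h.dn_zero, h.cn_zero, sn_sq_add_cn_sq]

theorem sn_sq_of_point_mem_locus {A B x y : ℝ} (hA : 1 < A) (hAB : A - 1 = (1 - m) * (B - 1))
    (hp : h.point x y ∈ locus (axisConic A B)) : B * sn φ y ^ 2 = B - 1 := by
  have hA0 : A ≠ 0 := by linarith
  have hB0 : B ≠ 0 := by linarith [one_lt_of_sub_one_eq h.m_lt_one hA hAB]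
  rw [point, mk_mem_locus, quad_axisConic] at hp
  simp only [Matrix.cons_val, mul_pow, h.dn_sq] at hp
  field_simp at hp
  have hfactor : (B - 1 - B * sn φ y ^ 2) * (m * sn φ x ^ 2 - A) = 0 := by
    linear_combination hp + A * B * sn_sq_add_cn_sq φ y - A * sn_sq_add_cn_sq φ x +
      sn φ x ^ 2 * hAB
  have hne : m * sn φ x ^ 2 - A ≠ 0 := by
    linarith [h.dn_sq x, sq_nonneg (dn m φ x)]
  linarith [(mul_eq_zero.1 hfactor).resolve_right hne]

end IsAmplitude

end TangentLines

section Sides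

theorem nsmul_apply_eq_nsmul_apply_zero {n : ℕ} [NeZero n] {G : Type*} [AddCommGroup G]
    {a : ZMod n → G} (ha : ∀ i, a (i + 1 + 1) - a (i + 1) = a (i + 1) - a i) (i : ZMod n) :
    n • a i = n • a 0 := by
  have hdiff (k : ℕ) : a (k + 1) - a k = a 1 - a 0 := by
    induction k with
    | zero => simp
    | succ k ih => rw [Nat.cast_succ, ha, ih]
  have hlinear (k : ℕ) : a k = a 0 + k • (a 1 - a 0) := by
    induction k with
    | zero => simp
    | succ k ih => rw [Nat.cast_succ, ← sub_add_cancel (a (k + 1)) (a k), hdiff, ih]; module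
  have htorsion : n • (a 1 - a 0) = 0 := by
    simpa using hlinear n
  rw [← ZMod.natCast_zmod_val i, hlinear, smul_add, smul_comm, htorsion, smul_zero, add_zero]

variable {n : ℕ}

theorem IsPonceletPolygon.not_onLine_add_two {γ Γ : Mat ℝ} {v : ZMod n → Plane ℝ}
    (hv : IsPonceletPolygon γ Γ v) (hn : 3 ≤ n) (hΓ : Γ.IsSymm) (hdet : Γ.det ≠ 0) {u : Line ℝ}
    {i : ZMod n} (hi : OnLine (v i) u) (hi' : OnLine (v (i + 1)) u) :
    ¬ OnLine (v (i + 1 + 1)) u := by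
  intro hi''
  rcases hv.eq_or_eq_of_onLine (by omega) hΓ hdet hi hi' hi'' (hv.2.1 _) with heq | heq
  · have htwo : ((2 : ℕ) : ZMod n) = 0 := by
      simpa [add_assoc, one_add_one_eq_two] using hv.1 heq
    exact absurd (Nat.le_of_dvd two_pos ((ZMod.natCast_eq_zero_iff 2 n).1 htwo)) (by omega)
  · exact hv.ne_add_one (by omega) (i + 1) heq.symm

namespace IsAmplitude

variable {m K A B : ℝ} {φ : ℝ → ℝ} (h : IsAmplitude m K φ)
include h

theorem coe_sub_eq_coe_sub (hB : B ≠ 0) {x y z : ℝ} (hxy : B * sn φ ((y - x) / 2) ^ 2 = B - 1)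
    (hyz : B * sn φ ((z - y) / 2) ^ 2 = B - 1) (hne : tangentLine φ x ≠ tangentLine φ z) :
    (z - y : AddCircle (4 * K)) = y - x := by
  obtain ⟨j, hj | hj⟩ := h.exists_eq_of_sn_sq_eq (mul_left_cancel₀ hB (hyz.trans hxy.symm))
  · rw [← sub_eq_zero, ← AddCircle.coe_sub, ← AddCircle.coe_sub, ← AddCircle.coe_sub,
      AddCircle.coe_eq_zero_iff]
    exact ⟨j, by rw [zsmul_eq_mul]; linarith⟩
  · exact absurd (h.tangentLine_eq_iff.2 ⟨j, by linarith⟩).symm hne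

-- A vertex on `axisConic A B` determines the difference of the tangency parameters of its two sides
-- up to sign, so that the parameters of consecutive sides form an arithmetic progression.
theorem exists_isSide_eq (hA : 1 < A) (hAB : A - 1 = (1 - m) * (B - 1)) (hn : 3 ≤ n)
    {v : ZMod n → Plane ℝ} (hv : IsPonceletPolygon (axisConic 1 1) (axisConic A B) v) :
    ∃ t₀ : ℝ, ∀ u, IsSide v u → ∃ j : ℤ, u = tangentLine φ (t₀ + 4 * K / n * j) := by
  have : NeZero n := ⟨by omega⟩
  have hB := one_lt_of_sub_one_eq h.m_lt_one hA hAB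
  have hdet : (axisConic A B).det ≠ 0 := by
    rw [det_axisConic]
    exact neg_ne_zero.2 (by positivity)
  choose S hS hS' using fun i : ZMod n => exists_onLine (v i) (v (i + 1))
  choose τ hτ using fun i => h.exists_eq_tangentLine (hv.2.2 (S i) ⟨i, hS i, hS' i⟩)
  simp only [hτ] at hS hS'
  have hnotMem (i : ZMod n) : ¬ OnLine (v (i + 1 + 1)) (tangentLine φ (τ i)) :=
    hv.not_onLine_add_two hn (isSymm_axisConic A B) hdet (hS i) (hS' i)
  have hsn (i : ZMod n) : B * sn φ ((τ (i + 1) - τ i) / 2) ^ 2 = B - 1 := by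
    have hne : tangentLine φ (τ (i + 1)) ≠ tangentLine φ (τ i) :=
      fun heq => hnotMem i (heq ▸ hS' (i + 1))
    exact h.sn_sq_of_point_mem_locus hA hAB (h.eq_point hne (hS (i + 1)) (hS' i) ▸ hv.2.1 (i + 1))
  have hstep (i : ZMod n) :
      (τ (i + 1 + 1) - τ (i + 1) : AddCircle (4 * K)) = τ (i + 1) - τ i :=
    h.coe_sub_eq_coe_sub (by positivity) (hsn i) (hsn (i + 1))
      fun heq => hnotMem i (heq ▸ hS (i + 1 + 1))
  refine ⟨τ 0, fun u ⟨i, hi, hi'⟩ => ?_⟩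
  obtain rfl : u = tangentLine φ (τ i) := by
    by_contra hne
    exact hv.ne_add_one (by omega) i (eq_of_onLine_of_onLine hne hi (hS i) hi' (hS' i))
  have hn0 : (n : ℝ) ≠ 0 := NeZero.ne _
  have hmultiple : n • (τ i : AddCircle (4 * K)) = n • τ 0 :=
    nsmul_apply_eq_nsmul_apply_zero (a := fun i => (τ i : AddCircle (4 * K))) hstep i
  rw [← sub_eq_zero, ← AddCircle.coe_nsmul, ← AddCircle.coe_nsmul, ← AddCircle.coe_sub,
    AddCircle.coe_eq_zero_iff] at hmultiple
  obtain ⟨j, hj⟩ := hmultiple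
  refine ⟨j, congrArg (tangentLine φ) ?_⟩
  simp only [zsmul_eq_mul, nsmul_eq_mul] at hj
  field_simp
  linarith

end IsAmplitude

end Sides

section Orientation

/-- A quarter of the determinant of the points with the angles `a`, `b`, `c` on the unit circle; it
is positive if these points are in counterclockwise order. -/
def orientation (a b c : ℝ) : ℝ :=
  Real.sin ((b - a) / 2) * Real.sin ((c - b) / 2) * Real.sin ((c - a) / 2)

theorem det_of_cos_sin_one (α : Fin 3 → ℝ) :
    (Matrix.of fun i => ![Real.cos (α i), Real.sin (α i), 1]).det =
      4 * orientation (α 0) (α 1) (α 2) := by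
  have hhalf (x y : ℝ) : Real.sin x + Real.sin y - Real.sin (x + y) =
      4 * (Real.sin (x / 2) * Real.sin (y / 2) * Real.sin ((x + y) / 2)) := by
    obtain ⟨x, rfl⟩ : ∃ a, x = 2 * a := ⟨x / 2, by ring⟩
    obtain ⟨y, rfl⟩ : ∃ b, y = 2 * b := ⟨y / 2, by ring⟩
    simp only [← mul_add, mul_div_cancel_left₀ _ (two_ne_zero (α := ℝ)), Real.sin_two_mul,
      Real.sin_add, Real.cos_add]
    linear_combination (-2 * Real.sin x * Real.cos x) * Real.sin_sq_add_cos_sq y -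
      2 * Real.sin y * Real.cos y * Real.sin_sq_add_cos_sq x
  have := hhalf (α 1 - α 0) (α 2 - α 1)
  rw [sub_add_sub_cancel'] at this
  rw [orientation, ← this, Matrix.det_fin_three]
  simp [Real.sin_sub]
  ring

theorem orientation_pos {a b c : ℝ} (hab : a < b) (hbc : b < c) (hca : c < a + 2 * Real.pi) :
    0 < orientation a b c := by
  have hsin {x y : ℝ} (hxy : x < y) (hyx : y < x + 2 * Real.pi) : 0 < Real.sin ((y - x) / 2) :=
    Real.sin_pos_of_pos_of_lt_pi (by linarith) (by linarith)
  exact mul_pos (mul_pos (hsin hab (by linarith)) (hsin hbc (by linarith)))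
    (hsin (hab.trans hbc) hca)

theorem orientation_swap (a b c : ℝ) : orientation a c b = -orientation a b c := by
  rw [orientation, orientation, ← neg_sub c b, neg_div, Real.sin_neg]
  ring

theorem orientation_sub (d a b c : ℝ) :
    orientation (d - a) (d - b) (d - c) = -orientation a b c := by
  simp only [orientation, sub_sub_sub_cancel_left, ← neg_sub b a, ← neg_sub c b, ← neg_sub c a,
    neg_div, Real.sin_neg]
  ring

theorem lt_of_orientation_pos {a b c : ℝ} (hb : b ∈ Set.Ico a (a + 2 * Real.pi))
    (hc : c ∈ Set.Ico a (a + 2 * Real.pi)) (h : 0 < orientation a b c) : a < b ∧ b < c := by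
  have hsin {x : ℝ} (hx : x ∈ Set.Ico a (a + 2 * Real.pi)) : 0 ≤ Real.sin ((x - a) / 2) :=
    Real.sin_nonneg_of_nonneg_of_le_pi (by linarith [hx.1]) (by linarith [hx.2])
  have hprod := pos_of_mul_pos_left h (hsin hc)
  refine ⟨hb.1.lt_of_ne fun hab => ?_, lt_of_not_ge fun hcb => ?_⟩
  · simp [← hab] at hprod
  · have hneg : Real.sin ((c - b) / 2) ≤ 0 :=
      Real.sin_nonpos_of_nonpos_of_neg_pi_le (by linarith) (by linarith [hb.2, hc.1])
    exact hprod.not_ge (mul_nonpos_of_nonneg_of_nonpos (hsin hb) hneg)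

theorem mul_pos_of_continuous_of_ne_zero {X : Type*} [TopologicalSpace X] [PreconnectedSpace X]
    {f : X → ℝ} (hf : Continuous f) (h0 : ∀ x, f x ≠ 0) (x y : X) : 0 < f x * f y := by
  by_contra! hxy
  obtain ⟨z, hz⟩ : (0 : ℝ) ∈ Set.range f := by
    rcases mul_nonpos_iff.1 hxy with h | h
    · exact mem_range_of_exists_le_of_exists_ge hf ⟨y, h.2⟩ ⟨x, h.1⟩
    · exact mem_range_of_exists_le_of_exists_ge hf ⟨x, h.1⟩ ⟨y, h.2⟩
  exact h0 z hz

theorem mulVec_eq_smul_of_smul_circlePoint_eq {g : GL (Fin 3) ℝ} {s t : ℝ}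
    (h : g • circlePoint s = circlePoint t) :
    (g : Mat ℝ) *ᵥ ![Real.cos s, Real.sin s, 1] =
      ((g : Mat ℝ) *ᵥ ![Real.cos s, Real.sin s, 1]) 2 • ![Real.cos t, Real.sin t, 1] := by
  rw [circlePoint, circlePoint, smul_mk, Projectivization.mk_eq_mk_iff'] at h
  obtain ⟨a, ha⟩ := h
  rw [← ha]
  simp

-- The homogeneous coordinate `R` of the image of `circlePoint t` has constant sign, and the
-- determinants of the lifts change by the factor `det g`.
theorem exists_mul_orientation_pos {g : GL (Fin 3) ℝ}
    (hg : ∀ t, g • circlePoint t ∈ locus (axisConic 1 1)) :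
    ∃ ε : ℝ, ∀ α β : Fin 3 → ℝ, (∀ i, g • circlePoint (α i) = circlePoint (β i)) →
      0 < orientation (α 0) (α 1) (α 2) → 0 < ε * orientation (β 0) (β 1) (β 2) := by
  set R : ℝ → ℝ := fun t => ((g : Mat ℝ) *ᵥ ![Real.cos t, Real.sin t, 1]) 2 with hR
  have hRcont : Continuous R := by
    simp only [hR, Matrix.mulVec, dotProduct, Fin.sum_univ_three, Matrix.cons_val]
    fun_prop
  have hRne (t : ℝ) : R t ≠ 0 := by
    have ht := hg t
    rw [circlePoint, smul_mk, mk_mem_locus, quad_axisConic] at ht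
    refine ne_zero_of_sq_add_sq_eq_sq (mulVec_ne_zero g fun h => ?_) (by linarith)
    simpa using congrFun h 2
  have hRpos := mul_pos_of_continuous_of_ne_zero hRcont hRne
  have hdet : (g : Mat ℝ).det ≠ 0 :=
    ((Matrix.isUnit_iff_isUnit_det _).1 (Units.isUnit g)).ne_zero
  refine ⟨(g : Mat ℝ).det * R 0, fun α β hαβ hα => ?_⟩
  have hlift : (Matrix.of fun i j => R (α i) *
      (Matrix.of fun i => ![Real.cos (β i), Real.sin (β i), 1]) i j) =
      (Matrix.of fun i => ![Real.cos (α i), Real.sin (α i), 1]) * (g : Mat ℝ)ᵀ := by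
    ext i j
    have hij := congrFun (mulVec_eq_smul_of_smul_circlePoint_eq (hαβ i)) j
    simp only [Matrix.of_apply, Matrix.mul_apply, Matrix.transpose_apply]
    rw [Pi.smul_apply, smul_eq_mul] at hij
    rw [← hij]
    exact dotProduct_comm ((g : Mat ℝ) j) _
  have hdetlift := congrArg Matrix.det hlift
  rw [Matrix.det_mul_column, Matrix.det_mul, Matrix.det_transpose, det_of_cos_sin_one,
    det_of_cos_sin_one, Fin.prod_univ_three] at hdetlift
  have hprod : R 0 * R (α 0) * (R (α 1) * R (α 2)) *
      ((g : Mat ℝ).det * R 0 * orientation (β 0) (β 1) (β 2)) =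
      (R 0 * (g : Mat ℝ).det) ^ 2 * orientation (α 0) (α 1) (α 2) := by
    linear_combination R 0 ^ 2 * (g : Mat ℝ).det * hdetlift / 4
  exact pos_of_mul_pos_right
    (hprod ▸ mul_pos (sq_pos_of_ne_zero (mul_ne_zero (hRne 0) hdet)) hα)
    (mul_pos (hRpos _ _) (hRpos _ _)).le

end Orientation

section Enumeration

theorem eqOn_id_of_strictMonoOn {α : Type*} [LinearOrder α] {s : Set α} [Finite s] {f : α → α}
    (hf : StrictMonoOn f s) (hs : Set.MapsTo f s s) : Set.EqOn f id s := fun x hx =>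
  congrArg Subtype.val (StrictMono.apply_eq (f := hs.restrict)
    (fun x y hxy => hf x.2 y.2 hxy) (x := ⟨x, hx⟩))

theorem strictMonoOn_or_strictAntiOn_of_orientation {n : ℤ} (hn : 3 ≤ n) {x : ℤ → ℝ} {ε : ℝ}
    (hx : ∀ i, x i ∈ Set.Ico (x 0) (x 0 + 2 * Real.pi))
    (hε : ∀ b c, 0 < b → b < c → c < n → 0 < ε * orientation (x 0) (x b) (x c)) :
    (∀ i ∈ Set.Ioo 0 n, x 0 < x i) ∧
      (StrictMonoOn x (Set.Ioo 0 n) ∨ StrictAntiOn x (Set.Ioo 0 n)) := by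
  have hcases : (∀ b c, 0 < b → b < c → c < n → x 0 < x b ∧ x b < x c) ∨
      ∀ b c, 0 < b → b < c → c < n → x 0 < x c ∧ x c < x b := by
    rcases le_or_gt ε 0 with h0 | h0
    · refine Or.inr fun b c hb hbc hc => lt_of_orientation_pos (hx c) (hx b) ?_
      rw [orientation_swap, neg_pos]
      exact neg_of_mul_pos_right (hε b c hb hbc hc) h0
    · exact Or.inl fun b c hb hbc hc => lt_of_orientation_pos (hx b) (hx c)
        (pos_of_mul_pos_right (hε b c hb hbc hc) h0.le)
  have hlt (i : ℤ) (hi : i ∈ Set.Ioo 0 n) : ∃ b c, 0 < b ∧ b < c ∧ c < n ∧ (i = b ∨ i = c) := by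
    rcases lt_or_ge 1 i with h | h
    · exact ⟨1, i, one_pos, h, hi.2, Or.inr rfl⟩
    · exact ⟨i, 2, hi.1, by omega, by omega, Or.inl rfl⟩
  refine ⟨fun i hi => ?_, hcases.imp (fun h b hb c hc hbc => (h b c hb.1 hbc hc.2).2)
    fun h b hb c hc hbc => (h b c hb.1 hbc hc.2).2⟩
  obtain ⟨b, c, hb, hbc, hc, rfl | rfl⟩ := hlt i hi <;> rcases hcases with h | h
  · exact (h _ _ hb hbc hc).1
  · exact (h _ _ hb hbc hc).1.trans (h _ _ hb hbc hc).2
  · exact (h _ _ hb hbc hc).1.trans (h _ _ hb hbc hc).2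
  · exact (h _ _ hb hbc hc).1

theorem exists_sign_of_strictMonoOn_or_strictAntiOn {n : ℤ} {μ : ℤ → ℤ} (h0 : μ 0 = 0)
    (hmaps : Set.MapsTo μ (Set.Ioo 0 n) (Set.Ioo 0 n))
    (hμ : StrictMonoOn μ (Set.Ioo 0 n) ∨ StrictAntiOn μ (Set.Ioo 0 n)) :
    ∃ s : ℤ, (s = 1 ∨ s = -1) ∧ ∀ i ∈ Set.Ico 0 n, μ i ≡ s * i [ZMOD n] := by
  rcases hμ with hμ | hμ
  · refine ⟨1, Or.inl rfl, fun i hi => ?_⟩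
    rcases hi.1.eq_or_lt with rfl | hi0
    · rw [h0, mul_zero]
    · rw [eqOn_id_of_strictMonoOn hμ hmaps ⟨hi0, hi.2⟩, one_mul, id]
  · refine ⟨-1, Or.inr rfl, fun i hi => ?_⟩
    rcases hi.1.eq_or_lt with rfl | hi0
    · rw [h0, mul_zero]
    · have hrefl := eqOn_id_of_strictMonoOn (f := fun i => n - μ i)
        (fun i hi j hj hij => sub_lt_sub_left (hμ hi hj hij) n)
        (fun i hi => ⟨sub_pos.2 (hmaps hi).2, sub_lt_self n (hmaps hi).1⟩) ⟨hi0, hi.2⟩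
      exact Int.modEq_iff_dvd.2 ⟨-1, by simp only [id] at hrefl; linarith⟩

theorem exists_sign_of_orientation {n : ℤ} (hn : 3 ≤ n) {ψ : ℝ → ℝ} (hψ : StrictMono ψ)
    (hψn : ψ n = ψ 0 + 2 * Real.pi) {μ : ℤ → ℤ} (hμ0 : μ 0 = 0) (hμ : ∀ i, μ i ∈ Set.Ico 0 n)
    {ε : ℝ} (hε : ∀ b c, 0 < b → b < c → c < n →
      0 < ε * orientation (ψ (μ 0)) (ψ (μ b)) (ψ (μ c))) :
    ∃ s : ℤ, (s = 1 ∨ s = -1) ∧ ∀ i ∈ Set.Ico 0 n, μ i ≡ s * i [ZMOD n] := by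
  have hlt (i j : ℤ) : ψ (μ i) < ψ (μ j) ↔ μ i < μ j := by
    rw [hψ.lt_iff_lt, Int.cast_lt]
  have hψμ (i : ℤ) : ψ (μ i) ∈ Set.Ico (ψ (μ 0)) (ψ (μ 0) + 2 * Real.pi) := by
    rw [hμ0, Int.cast_zero, ← hψn]
    exact ⟨hψ.monotone (Int.cast_nonneg (hμ i).1), hψ (Int.cast_lt.2 (hμ i).2)⟩
  obtain ⟨hpos, hmono⟩ := strictMonoOn_or_strictAntiOn_of_orientation hn
    (x := fun i => ψ (μ i)) hψμ hε
  refine exists_sign_of_strictMonoOn_or_strictAntiOn hμ0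
    (fun i hi => ⟨hμ0 ▸ (hlt 0 i).1 (hpos i hi), (hμ i).2⟩) ?_
  exact hmono.imp (fun hm i hi j hj hij => (hlt i j).1 (hm hi hj hij))
    fun hm i hi j hj hij => (hlt j i).1 (hm hi hj hij)

variable {m K : ℝ} {φ : ℝ → ℝ} {n : ℕ}

theorem IsAmplitude.tangentLine_eq_of_modEq (h : IsAmplitude m K φ) (hn : n ≠ 0) (u : ℝ)
    {a b : ℤ} (hab : a ≡ b [ZMOD n]) :
    tangentLine φ (u + 4 * K / n * a) = tangentLine φ (u + 4 * K / n * b) := by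
  obtain ⟨j, hj⟩ := hab.symm.dvd
  have hj' : (a : ℝ) - b = n * j := by exact_mod_cast hj
  rw [h.tangentLine_eq_iff]
  refine ⟨j, ?_⟩
  rw [← sub_add_cancel (a : ℝ) b, hj']
  field_simp
  ring

theorem IsAmplitude.point_zero_eq_circlePoint (h : IsAmplitude m K φ) (t : ℝ) :
    h.point t 0 = circlePoint (Real.pi / 2 - φ t) := by
  simp only [point, circlePoint, h.dn_zero, mul_one, Real.cos_pi_div_two_sub,
    Real.sin_pi_div_two_sub, sn, cn]
  simp only [h.map_zero, Real.cos_zero]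

theorem IsAmplitude.exists_mul_orientation_pos (h : IsAmplitude m K φ) {v : ZMod n → Plane ℝ}
    {ℓ : ZMod n → Line ℝ} (hcyc : IsCyclicEnumeration (axisConic 1 1) v ℓ) {x : ℤ → ℝ}
    (hx : ∀ i : ℤ, ℓ i = tangentLine φ (x i)) :
    ∃ ε : ℝ, ∀ a b c : ℤ, a < b → b < c → c < a + n →
      0 < ε * orientation (φ (x a)) (φ (x b)) (φ (x c)) := by
  obtain ⟨-, g, θ, hg, hθ, hper, hon⟩ := hcyc
  have hcircle (t : ℝ) : g • circlePoint t ∈ locus (axisConic 1 1) :=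
    hg ▸ Set.smul_mem_smul_set ⟨t, rfl⟩
  have hθx (i : ℤ) : g • circlePoint (θ i) = circlePoint (Real.pi / 2 - φ (x i)) := by
    rw [← h.point_zero_eq_circlePoint]
    exact h.eq_point_zero (hx i ▸ hon i) (hcircle _)
  obtain ⟨ε, hε⟩ := PonceletGrid.exists_mul_orientation_pos hcircle
  refine ⟨-ε, fun a b c hab hbc hca => ?_⟩
  have hpos := hε (θ ∘ ![a, b, c]) (fun i => Real.pi / 2 - φ (x (![a, b, c] i))) (fun i => hθx _)
    (orientation_pos (hθ hab) (hθ hbc) (hper a ▸ hθ hca))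
  simpa [orientation_sub] using hpos

theorem IsAmplitude.exists_enumeration (h : IsAmplitude m K φ) (hn : 3 ≤ n) {v : ZMod n → Plane ℝ}
    {ℓ : ZMod n → Line ℝ} (hcyc : IsCyclicEnumeration (axisConic 1 1) v ℓ) {t₀ : ℝ}
    (hside : ∀ u, IsSide v u → ∃ j : ℤ, u = tangentLine φ (t₀ + 4 * K / n * j)) :
    ∃ u₀ δ : ℝ, (n * δ = 2 * K ∨ n * δ = -(2 * K)) ∧
      ∀ i : ℤ, ℓ i = tangentLine φ (u₀ + 2 * i * δ) := by
  have hnpos : (0 : ℝ) < n := by positivity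
  have hnpos' : (0 : ℤ) < n := by positivity
  have hℓ (i : ZMod n) : ℓ i ∈ {u | IsSide v u} := hcyc.1 ▸ Set.mem_range_self i
  choose J hJ using fun i => hside (ℓ i) (hℓ i)
  set u₀ := t₀ + 4 * K / n * J 0 with hu₀
  set μ : ℤ → ℤ := fun i => (J i - J 0) % n with hμ
  have hμmem (i : ℤ) : μ i ∈ Set.Ico (0 : ℤ) n :=
    ⟨Int.emod_nonneg _ hnpos'.ne', Int.emod_lt_of_pos _ hnpos'⟩
  have hℓμ (i : ℤ) : ℓ i = tangentLine φ (u₀ + 4 * K / n * μ i) := by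
    rw [h.tangentLine_eq_of_modEq (by omega) u₀ (Int.mod_modEq _ _), hJ, hu₀]
    push_cast
    ring_nf
  set ψ : ℝ → ℝ := fun r => φ (u₀ + 4 * K / n * r) with hψ
  have hψmono : StrictMono ψ := h.strictMono.comp
    ((strictMono_mul_left_of_pos (by have := h.K_pos; positivity)).const_add u₀)
  have hψn : ψ n = ψ 0 + 2 * Real.pi := by
    simpa [hψ, div_mul_cancel₀ _ hnpos.ne'] using h.add_four_K u₀ 1
  obtain ⟨ε, hε⟩ := h.exists_mul_orientation_pos hcyc hℓμ
  obtain ⟨s, hs, hμs⟩ := exists_sign_of_orientation (n := n) (by exact_mod_cast hn) hψmono hψn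
    (by simp [hμ]) hμmem fun b c hb hbc hc => hε 0 b c hb hbc (by simpa using hc)
  refine ⟨u₀, s * (2 * K / n), ?_, fun i => ?_⟩
  · rcases hs with rfl | rfl
    · left; push_cast; field_simp
    · right; push_cast; field_simp
  have hi : μ (i % n) ≡ s * i [ZMOD n] :=
    (hμs _ ⟨Int.emod_nonneg _ hnpos'.ne', Int.emod_lt_of_pos _ hnpos'⟩).trans
      ((Int.mod_modEq _ _).mul_left s)
  rw [← ZMod.intCast_mod i n, hℓμ, h.tangentLine_eq_of_modEq (by omega) u₀ hi]
  push_cast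
  ring_nf

end Enumeration

section DiagonalMaps

/-- The linear map `(x, y) ↦ (a x, b y)` of the affine plane `z ≠ 0`. -/
def diagGL (a b : ℝˣ) : GL (Fin 3) ℝ where
  val := Matrix.diagonal ![a, b, 1]
  inv := Matrix.diagonal ![↑a⁻¹, ↑b⁻¹, 1]
  val_inv := by
    rw [Matrix.diagonal_mul_diagonal, Matrix.diagonal_eq_one]
    ext i
    fin_cases i <;> simp
  inv_val := by
    rw [Matrix.diagonal_mul_diagonal, Matrix.diagonal_eq_one]
    ext i
    fin_cases i <;> simp

theorem diagGL_inv (a b : ℝˣ) : (diagGL a b)⁻¹ = diagGL a⁻¹ b⁻¹ :=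
  Units.ext rfl

theorem diagGL_mul (a b c d : ℝˣ) : diagGL a b * diagGL c d = diagGL (a * c) (b * d) := by
  refine Units.ext ((Matrix.diagonal_mul_diagonal _ _).trans (congrArg Matrix.diagonal ?_))
  ext i
  fin_cases i <;> simp

theorem diagGL_mulVec (a b : ℝˣ) (w : Fin 3 → ℝ) :
    (diagGL a b : Mat ℝ) *ᵥ w = ![a * w 0, b * w 1, w 2] := by
  ext i
  fin_cases i <;> simp [diagGL, Matrix.mulVec_diagonal]

theorem conicImage_diagGL_diagonal (a b : ℝˣ) (x y z : ℝ) :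
    conicImage (diagGL a b) (Matrix.diagonal ![x, y, z]) =
      Matrix.diagonal ![x / a ^ 2, y / b ^ 2, z] := by
  rw [conicImage, diagGL_inv]
  change (Matrix.diagonal _)ᵀ * Matrix.diagonal _ * Matrix.diagonal _ = _
  rw [Matrix.diagonal_transpose, Matrix.diagonal_mul_diagonal, Matrix.diagonal_mul_diagonal]
  congr 1
  ext i
  fin_cases i <;> simp <;> field_simp

theorem isLinear_diagGL (a b : ℝˣ) : IsLinear (diagGL a b) := by
  simp [IsLinear, diagGL]

theorem exists_diagGL_smul_eq {X Y Z : Set (Plane ℝ)} (hX : ∃ a b, X = diagGL a b • Z)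
    (hY : ∃ a b, Y = diagGL a b • Z) : ∃ a b, diagGL a b • X = Y := by
  obtain ⟨a, b, rfl⟩ := hX
  obtain ⟨c, d, rfl⟩ := hY
  exact ⟨c * a⁻¹, d * b⁻¹, by rw [← diagGL_mul, ← diagGL_inv, mul_smul, inv_smul_smul]⟩

end DiagonalMaps

section Grid

theorem exists_two_mul_intCast_eq {n : ℕ} (hn : Odd n) (k : ZMod n) :
    ∃ l : ℤ, ((2 * l : ℤ) : ZMod n) = k := by
  obtain ⟨r, hr⟩ := hn
  obtain ⟨k, rfl⟩ := ZMod.intCast_surjective k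
  refine ⟨k * (r + 1), ?_⟩
  have hmod : (2 * (k * (r + 1)) : ℤ) = k + k * n := by rw [hr]; push_cast; ring
  rw [hmod]
  simp

namespace IsAmplitude

variable {n : ℕ} {m K u₀ δ : ℝ} {φ : ℝ → ℝ} {ℓ : ZMod n → Line ℝ} (h : IsAmplitude m K φ)
include h

theorem sn_two_mul_eq_zero_iff {x : ℝ} : sn φ (2 * x) = 0 ↔ sn φ x = 0 ∨ cn φ x = 0 := by
  have hadd := h.sn_add x x
  rw [← two_mul] at hadd
  rw [← mul_eq_zero_iff_right (h.one_sub_mul_sn_sq_mul_sn_sq_pos x x).ne', hadd]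
  simp [(h.dn_pos x).ne', ← two_mul]

theorem sn_eq_zero_of_tangentLine_add_eq_sub {x y : ℝ}
    (hxy : tangentLine φ (x + y) = tangentLine φ (x - y)) : sn φ y = 0 := by
  obtain ⟨j, hj⟩ := h.tangentLine_eq_iff.1 hxy
  exact h.sn_eq_zero_iff.2 ⟨j, by linarith⟩

theorem quad_axisConic_one_one_point (x y : ℝ) :
    quad (axisConic 1 1) ![sn φ x * dn m φ y, cn φ x, cn φ y] =
      (dn m φ x * sn φ y) ^ 2 := by
  rw [quad_axisConic]
  simp only [Matrix.cons_val, mul_pow, h.dn_sq, div_one]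
  linear_combination sn_sq_add_cn_sq φ x - sn_sq_add_cn_sq φ y

theorem point_mem_locus_of_sn_eq_zero {y : ℝ} (hy : sn φ y = 0) (x : ℝ) :
    h.point x y ∈ locus (axisConic 1 1) := by
  rw [point, mk_mem_locus, h.quad_axisConic_one_one_point, hy]
  simp

theorem eq_point_iff {x y : ℝ} {p : Plane ℝ} :
    p = h.point x y ↔ OnLine p (tangentLine φ (x + y)) ∧ OnLine p (tangentLine φ (x - y)) ∧
      (sn φ y = 0 → p ∈ locus (axisConic 1 1)) := by
  have hadd := h.onLine_point_add x y
  have hsub := h.onLine_point_sub x y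
  constructor
  · rintro rfl
    exact ⟨hadd, hsub, fun hy => h.point_mem_locus_of_sn_eq_zero hy x⟩
  · rintro ⟨hp, hp', hlocus⟩
    by_cases hy : sn φ y = 0
    · exact (h.eq_point_zero hp (hlocus hy)).trans
        (h.eq_point_zero hadd (h.point_mem_locus_of_sn_eq_zero hy x)).symm
    · exact eq_of_onLine_of_onLine (mt h.sn_eq_zero_of_tangentLine_add_eq_sub hy) hp hp' hadd hsub

theorem exists_point_eq_diagGL_smul_point_zero {y : ℝ} (hy : cn φ y ≠ 0) :
    ∃ a b, ∀ x, h.point x y = diagGL a b • h.point x 0 := by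
  refine ⟨Units.mk0 (dn m φ y) (h.dn_pos y).ne' / Units.mk0 _ hy, (Units.mk0 _ hy)⁻¹,
    fun x => ?_⟩
  rw [point, point, smul_mk]
  refine mk_eq_mk_of_smul_eq (a := cn φ y) _ _ ?_
  rw [diagGL_mulVec]
  ext i
  fin_cases i <;> simp [h.dn_zero, h.cn_zero] <;> field_simp

theorem exists_point_eq_diagGL_smul {x : ℝ} (hs : sn φ x ≠ 0) (hc : cn φ x ≠ 0) :
    ∃ a b, ∀ y, h.point x y = diagGL a b •
      Projectivization.mk ℝ ![dn m φ y, 1, cn φ y] (fun h => by simpa using congrFun h 1) := by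
  refine ⟨Units.mk0 _ hs, Units.mk0 _ hc, fun y => ?_⟩
  rw [smul_mk, point]
  congr 1
  rw [diagGL_mulVec]
  ext i
  fin_cases i <;> simp

variable (hδ : n * δ = 2 * K ∨ n * δ = -(2 * K))
include hδ

theorem sn_int_mul_eq_zero_iff (i : ℤ) : sn φ (i * δ) = 0 ↔ (n : ℤ) ∣ i := by
  have hK := h.K_pos.ne'
  rw [h.sn_eq_zero_iff]
  constructor
  · rintro ⟨j, hj⟩
    have hi : (i : ℝ) = n * j ∨ (i : ℝ) = n * (-j) := by
      rcases hδ with hδ | hδ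
      · left
        refine mul_left_cancel₀ (mul_ne_zero two_ne_zero hK) ?_
        linear_combination n * hj - i * hδ
      · right
        refine mul_left_cancel₀ (mul_ne_zero two_ne_zero hK) ?_
        linear_combination -n * hj + i * hδ
    rcases hi with hi | hi
    · exact ⟨j, by exact_mod_cast hi⟩
    · exact ⟨-j, by exact_mod_cast hi⟩
  · rintro ⟨j, rfl⟩
    rcases hδ with hδ | hδ
    · exact ⟨j, by push_cast; linear_combination j * hδ⟩
    · exact ⟨-j, by push_cast; linear_combination j * hδ⟩

theorem cn_int_mul_ne_zero (hn : Odd n) (k : ℤ) : cn φ (k * δ) ≠ 0 := by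
  intro hc
  have hs : sn φ (k * δ) ≠ 0 := fun hs => by
    simpa [hs, hc] using sn_sq_add_cn_sq φ (k * δ)
  have hs2 : sn φ ((2 * k : ℤ) * δ) = 0 := by
    push_cast
    rw [mul_assoc]
    exact h.sn_two_mul_eq_zero_iff.2 (Or.inr hc)
  rw [ne_eq, h.sn_int_mul_eq_zero_iff hδ] at hs
  rw [h.sn_int_mul_eq_zero_iff hδ] at hs2
  refine hs ((Int.isCoprime_iff_gcd_eq_one.2 ?_).dvd_of_dvd_mul_left hs2)
  exact_mod_cast Nat.coprime_two_right.2 hn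

variable (hℓ : ∀ i : ℤ, ℓ i = tangentLine φ (u₀ + 2 * i * δ))
include hℓ

theorem gridPoint_eq (i j : ℤ) :
    gridPoint (axisConic 1 1) ℓ i j = {h.point (u₀ + (i + j) * δ) ((i - j) * δ)} := by
  have hij : (i : ZMod n) = j ↔ sn φ ((i - j) * δ) = 0 := by
    rw [eq_comm, ZMod.intCast_eq_intCast_iff_dvd_sub, ← h.sn_int_mul_eq_zero_iff hδ,
      Int.cast_sub]
  ext p
  rw [gridPoint, Set.mem_ofPred_eq, Set.mem_singleton_iff, h.eq_point_iff, hℓ, hℓ, hij]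
  ring_nf

theorem gridP_eq (k : ℤ) :
    gridP (axisConic 1 1) ℓ k = Set.range fun j : ℤ => h.point (u₀ + (2 * j + k) * δ) (k * δ) := by
  have hgrid (j : ℤ) : gridPoint (axisConic 1 1) ℓ ((j + k : ℤ) : ZMod n) j =
      {h.point (u₀ + (2 * j + k) * δ) (k * δ)} := by
    rw [h.gridPoint_eq hδ hℓ]
    push_cast
    ring_nf
  ext p
  simp only [gridP, Set.mem_ofPred_eq, Set.mem_range, sub_eq_iff_eq_add]
  constructor
  · rintro ⟨_, j, rfl, hp⟩
    obtain ⟨j, rfl⟩ := ZMod.intCast_surjective j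
    rw [← Int.cast_add, add_comm, hgrid] at hp
    exact ⟨j, hp.symm⟩
  · rintro ⟨j, rfl⟩
    exact ⟨(j + k : ℤ), j, by push_cast; ring, by rw [hgrid, Set.mem_singleton_iff]⟩

theorem gridQ_eq (k : ℤ) :
    gridQ (axisConic 1 1) ℓ k = Set.range fun j : ℤ => h.point (u₀ + k * δ) ((k - 2 * j) * δ) := by
  have hgrid (j : ℤ) : gridPoint (axisConic 1 1) ℓ ((k - j : ℤ) : ZMod n) j =
      {h.point (u₀ + k * δ) ((k - 2 * j) * δ)} := by
    rw [h.gridPoint_eq hδ hℓ]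
    push_cast
    ring_nf
  ext p
  simp only [gridQ, Set.mem_ofPred_eq, Set.mem_range, ← eq_sub_iff_add_eq]
  constructor
  · rintro ⟨_, j, rfl, hp⟩
    obtain ⟨j, rfl⟩ := ZMod.intCast_surjective j
    rw [← Int.cast_sub, hgrid] at hp
    exact ⟨j, hp.symm⟩
  · rintro ⟨j, rfl⟩
    exact ⟨(k - j : ℤ), j, by push_cast; ring, by rw [hgrid, Set.mem_singleton_iff]⟩

theorem exists_diagGL_smul_gridP (hn : Odd n) (j k : ZMod n) :
    ∃ a b, diagGL a b • gridP (axisConic 1 1) ℓ j = gridP (axisConic 1 1) ℓ k := by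
  have hscale (k : ZMod n) : ∃ a b, gridP (axisConic 1 1) ℓ k = diagGL a b •
      Set.range fun j : ℤ => h.point (u₀ + 2 * j * δ) 0 := by
    obtain ⟨l, rfl⟩ := exists_two_mul_intCast_eq hn k
    obtain ⟨a, b, hab⟩ :=
      h.exists_point_eq_diagGL_smul_point_zero (h.cn_int_mul_ne_zero hδ hn (2 * l))
    refine ⟨a, b, ?_⟩
    rw [h.gridP_eq hδ hℓ, ← Set.image_smul, ← Set.range_comp,
      ← (Equiv.subRight l).surjective.range_comp]
    congr 1
    ext1 i
    simp only [Function.comp_apply, Equiv.subRight_apply]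
    rw [← hab]
    push_cast
    ring_nf
  exact exists_diagGL_smul_eq (hscale j) (hscale k)

theorem exists_diagGL_smul_gridQ (hn : Odd n)
    (hsc : ∀ k : ℤ, sn φ (u₀ + k * δ) ≠ 0 ∧ cn φ (u₀ + k * δ) ≠ 0) (j k : ZMod n) :
    ∃ a b, diagGL a b • gridQ (axisConic 1 1) ℓ j = gridQ (axisConic 1 1) ℓ k := by
  have hscale (k : ZMod n) : ∃ a b, gridQ (axisConic 1 1) ℓ k = diagGL a b •
      Set.range fun j : ℤ => Projectivization.mk ℝ ![dn m φ (2 * j * δ), 1, cn φ (2 * j * δ)]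
        (fun h => by simpa using congrFun h 1) := by
    obtain ⟨l, rfl⟩ := exists_two_mul_intCast_eq hn k
    obtain ⟨a, b, hab⟩ := h.exists_point_eq_diagGL_smul (hsc (2 * l)).1 (hsc (2 * l)).2
    refine ⟨a, b, ?_⟩
    rw [h.gridQ_eq hδ hℓ, ← Set.image_smul, ← Set.range_comp,
      ← (Equiv.subLeft l).surjective.range_comp]
    congr 1
    ext1 i
    simp only [Function.comp_apply, Equiv.subLeft_apply]
    rw [← hab]
    push_cast
    ring_nf
  exact exists_diagGL_smul_eq (hscale j) (hscale k)

end IsAmplitude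

end Grid

section Symmetry

variable {c s : ℝ} (hcs : c ^ 2 + s ^ 2 = 1)

include hcs in
theorem reflection_mul_self :
    !![-c, s, 0; s, c, 0; 0, 0, 1] * !![-c, s, 0; s, c, 0; 0, 0, 1] = 1 := by
  rw [Matrix.mul_fin_three, Matrix.one_fin_three]
  congrm !![?_, ?_, ?_; ?_, ?_, ?_; ?_, ?_, ?_] <;> first | ring1 | linear_combination hcs

theorem transpose_reflection (c s : ℝ) :
    (!![-c, s, 0; s, c, 0; 0, 0, 1])ᵀ = !![-c, s, 0; s, c, 0; 0, 0, 1] := by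
  ext i j
  fin_cases i <;> fin_cases j <;> rfl

/-- The reflection in the line through the origin that takes the direction `(0, 1)` to the direction
`(s, c)`. -/
def reflectionGL (hcs : c ^ 2 + s ^ 2 = 1) : GL (Fin 3) ℝ :=
  ⟨!![-c, s, 0; s, c, 0; 0, 0, 1], !![-c, s, 0; s, c, 0; 0, 0, 1], reflection_mul_self hcs,
    reflection_mul_self hcs⟩

theorem val_reflectionGL : (reflectionGL hcs : Mat ℝ) = !![-c, s, 0; s, c, 0; 0, 0, 1] := rfl

theorem val_inv_reflectionGL :
    ((reflectionGL hcs)⁻¹ : GL (Fin 3) ℝ).val = !![-c, s, 0; s, c, 0; 0, 0, 1] := rfl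

theorem dual_reflectionGL : dual (reflectionGL hcs) = reflectionGL hcs :=
  Units.ext (transpose_reflection c s)

theorem conicImage_reflectionGL_axisConic {A B : ℝ} (h : s = 0 ∨ A = B) :
    conicImage (reflectionGL hcs) (axisConic A B) = axisConic A B := by
  have hAB : s * (1 / A - 1 / B) = 0 := by rcases h with rfl | rfl <;> ring
  rw [conicImage, val_inv_reflectionGL, transpose_reflection, axisConic,
    Matrix.diagonal_vec3, Matrix.mul_fin_three, Matrix.mul_fin_three]
  congrm !![?_, ?_, ?_; ?_, ?_, ?_; ?_, ?_, ?_] <;> first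
    | ring1
    | linear_combination -c * hAB
    | linear_combination 1 / A * hcs - s * hAB
    | linear_combination 1 / B * hcs + s * hAB

theorem exists_reflectionGL_smul_ne : ∃ p : Plane ℝ, reflectionGL hcs • p ≠ p := by
  by_contra! hfix
  have hx := hfix (Projectivization.mk ℝ ![1, 0, 1] (fun h => by simpa using congrFun h 2))
  have hy := hfix (Projectivization.mk ℝ ![0, 1, 1] (fun h => by simpa using congrFun h 2))
  rw [smul_mk, Projectivization.mk_eq_mk_iff', val_reflectionGL] at hx hy
  obtain ⟨a, ha⟩ := hx
  obtain ⟨b, hb⟩ := hy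
  obtain rfl : a = 1 := by simpa [Matrix.vecHead, Matrix.vecTail] using congrFun ha 2
  obtain rfl : b = 1 := by simpa [Matrix.vecHead, Matrix.vecTail] using congrFun hb 2
  have hc : 1 = -c := by simpa [Matrix.vecHead, Matrix.vecTail] using congrFun ha 0
  have hc' : 1 = c := by simpa [Matrix.vecHead, Matrix.vecTail] using congrFun hb 1
  linarith

theorem reflectionGL_smul_tangentLine {φ : ℝ → ℝ} {t t' : ℝ}
    (hs : sn φ t' = s * cn φ t - c * sn φ t) (hc : cn φ t' = c * cn φ t + s * sn φ t) :
    reflectionGL hcs • tangentLine φ t = tangentLine φ t' := by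
  rw [tangentLine, tangentLine, smul_mk]
  congr 1
  rw [val_reflectionGL, hs, hc]
  ext j
  fin_cases j <;> simp [Matrix.vecHead, Matrix.vecTail] <;> ring

namespace IsAmplitude

variable {n : ℕ} {m K A B u₀ δ : ℝ} {φ : ℝ → ℝ} {v : ZMod n → Plane ℝ} {ℓ : ZMod n → Line ℝ}
  (h : IsAmplitude m K φ)
include h

theorem det_axisConic_ne_zero (hA : 1 < A) (hAB : A - 1 = (1 - m) * (B - 1)) :
    (axisConic A B).det ≠ 0 := by
  have hA0 : A ≠ 0 := by linarith
  have hB0 : B ≠ 0 := by linarith [one_lt_of_sub_one_eq h.m_lt_one hA hAB]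
  rw [det_axisConic]
  simp [hA0, hB0]

section

variable (hA : 1 < A) (hAB : A - 1 = (1 - m) * (B - 1)) (hn : 2 ≤ n)
  (hv : IsPonceletPolygon (axisConic 1 1) (axisConic A B) v)
  (hside : Set.range ℓ = {u | IsSide v u})
  (hℓ : ∀ i : ℤ, ℓ i = tangentLine φ (u₀ + 2 * i * δ))
  (hsym : HasNoSymmetry (axisConic 1 1) (axisConic A B) v)
include hA hAB hn hv hside hℓ hsym

theorem exists_reflectionGL_smul_tangentLine_ne (hconic : s = 0 ∨ A = B) (k : ℤ) :
    ∃ t, reflectionGL hcs • tangentLine φ t ≠ tangentLine φ (2 * (u₀ + k * δ) - t) := by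
  by_contra! hrefl
  obtain ⟨p, hp⟩ := exists_reflectionGL_smul_ne hcs
  refine hp (hsym.smul_eq_self hv hn (isSymm_axisConic A B) (h.det_axisConic_ne_zero hA hAB)
    (by rw [smul_locus, conicImage_reflectionGL_axisConic hcs (Or.inr rfl)])
    (by rw [smul_locus, conicImage_reflectionGL_axisConic hcs hconic]) (fun u hu => ?_) p)
  change u ∈ {u | IsSide v u} at hu
  change _ ∈ {u | IsSide v u}
  rw [← hside] at hu ⊢
  obtain ⟨i, rfl⟩ := hu
  obtain ⟨i, rfl⟩ := ZMod.intCast_surjective i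
  refine ⟨(k - i : ℤ), ?_⟩
  rw [dual_reflectionGL, hℓ, hℓ, hrefl]
  push_cast
  ring_nf

theorem ne_zero_of_hasNoSymmetry : m ≠ 0 := by
  rintro rfl
  have hdn (t : ℝ) : dn 0 φ t = 1 := by simp [dn]
  obtain ⟨t, ht⟩ := h.exists_reflectionGL_smul_tangentLine_ne (c := cn φ (2 * u₀))
    (s := sn φ (2 * u₀)) (by linarith [sn_sq_add_cn_sq φ (2 * u₀)]) hA hAB hn hv hside hℓ hsym
    (Or.inr (by linarith)) 0
  refine ht (reflectionGL_smul_tangentLine _ ?_ ?_)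
  · have hadd := h.sn_add (2 * u₀) (-t)
    simp only [hdn, h.sn_neg, h.cn_neg] at hadd
    simp only [Int.cast_zero, zero_mul, add_zero, sub_eq_add_neg]
    linarith
  · have hadd := h.cn_add (2 * u₀) (-t)
    simp only [hdn, h.sn_neg, h.cn_neg] at hadd
    simp only [Int.cast_zero, zero_mul, add_zero, sub_eq_add_neg]
    linarith

theorem sn_ne_zero_of_hasNoSymmetry (k : ℤ) : sn φ (u₀ + k * δ) ≠ 0 := by
  intro hs
  obtain ⟨j, hj⟩ := h.sn_eq_zero_iff.1 hs
  obtain ⟨t, ht⟩ := h.exists_reflectionGL_smul_tangentLine_ne (c := 1) (s := 0) (by norm_num)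
    hA hAB hn hv hside hℓ hsym (Or.inl rfl) k
  have hper : 2 * (u₀ + k * δ) - t = -t + 4 * K * j := by linear_combination 2 * hj
  refine ht (reflectionGL_smul_tangentLine _ ?_ ?_) <;>
    simp [hper, h.sn_add_four_K, h.cn_add_four_K, h.sn_neg, h.cn_neg]

theorem cn_ne_zero_of_hasNoSymmetry (k : ℤ) : cn φ (u₀ + k * δ) ≠ 0 := by
  intro hc
  obtain ⟨j, hj⟩ := h.exists_eq_of_cn_eq_zero hc
  obtain ⟨t, ht⟩ := h.exists_reflectionGL_smul_tangentLine_ne (c := -1) (s := 0) (by norm_num)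
    hA hAB hn hv hside hℓ hsym (Or.inl rfl) k
  have hper : 2 * (u₀ + k * δ) - t = 2 * K - t + 4 * K * j := by linear_combination 2 * hj
  refine ht (reflectionGL_smul_tangentLine _ ?_ ?_) <;>
    simp [hper, h.sn_add_four_K, h.cn_add_four_K, h.sn_two_K_sub, h.cn_two_K_sub]

end

theorem sn_sub_eq_zero_or_sn_add_eq_zero {x y : ℝ} (hxy : sn φ x ^ 2 = sn φ y ^ 2) :
    sn φ (x - y) = 0 ∨ sn φ (x + y) = 0 := by
  obtain ⟨j, rfl | rfl⟩ := h.exists_eq_of_sn_sq_eq hxy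
  · exact Or.inl (h.sn_eq_zero_iff.2 ⟨j, by ring⟩)
  · exact Or.inr (h.sn_eq_zero_iff.2 ⟨j, by ring⟩)

theorem intCast_two_mul_eq_of_sn_sq_eq (hδ : n * δ = 2 * K ∨ n * δ = -(2 * K))
    (hsc : ∀ k : ℤ, sn φ (u₀ + k * δ) ≠ 0 ∧ cn φ (u₀ + k * δ) ≠ 0) {k l : ℤ}
    (hkl : sn φ (u₀ + 2 * k * δ) ^ 2 = sn φ (u₀ + 2 * l * δ) ^ 2) :
    ((2 * k : ℤ) : ZMod n) = (2 * l : ℤ) := by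
  rcases h.sn_sub_eq_zero_or_sn_add_eq_zero hkl with hsub | hadd
  · rw [eq_comm, ZMod.intCast_eq_intCast_iff_dvd_sub, ← h.sn_int_mul_eq_zero_iff hδ, ← hsub]
    push_cast
    ring_nf
  · rw [show u₀ + 2 * k * δ + (u₀ + 2 * l * δ) = 2 * (u₀ + (k + l : ℤ) * δ) by push_cast; ring,
      h.sn_two_mul_eq_zero_iff] at hadd
    exact (not_or.2 (hsc (k + l)) hadd).elim

end IsAmplitude

end Symmetry

section CommonTangents

section

variable {F : Type*} [Field F]

theorem quad_adjugate_transpose_mul_mul (G N : Mat F) (w : Fin 3 → F) :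
    quad (Gᵀ * N * G).adjugate w = quad N.adjugate (G.adjugateᵀ *ᵥ w) := by
  rw [quad_mulVec, Matrix.adjugate_mul_distrib, Matrix.adjugate_mul_distrib,
    ← Matrix.adjugate_transpose, Matrix.transpose_transpose, Matrix.mul_assoc]

theorem quad_adjugate_transpose_mul_mul_mulVec (G N : Mat F) (w : Fin 3 → F) :
    quad (Gᵀ * N * G).adjugate (Gᵀ *ᵥ w) = G.det ^ 2 * quad N.adjugate w := by
  rw [quad_adjugate_transpose_mul_mul, Matrix.mulVec_mulVec, ← Matrix.transpose_mul,
    Matrix.mul_adjugate, Matrix.transpose_smul, Matrix.transpose_one, Matrix.smul_mulVec,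
    Matrix.one_mulVec, quad_smul]

theorem isTangent_transpose_mul_mul_mk_iff [NeZero (2 : F)] {G N : Mat F} (hG : G.det ≠ 0)
    (hN : N.IsSymm) (hdet : N.det ≠ 0) {w : Fin 3 → F} (hw : Gᵀ *ᵥ w ≠ 0) :
    IsTangent (Gᵀ * N * G) (Projectivization.mk F (Gᵀ *ᵥ w) hw) ↔ quad N.adjugate w = 0 := by
  have hsymm : (Gᵀ * N * G).IsSymm := by
    rw [Matrix.IsSymm, Matrix.transpose_mul, Matrix.transpose_mul, Matrix.transpose_transpose,
      hN.eq, Matrix.mul_assoc]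
  have hdet' : (Gᵀ * N * G).det ≠ 0 := by
    rw [Matrix.det_mul, Matrix.det_mul, Matrix.det_transpose]
    exact mul_ne_zero (mul_ne_zero hG hdet) hG
  rw [isTangent_mk_iff hsymm hdet', quad_adjugate_transpose_mul_mul_mulVec, mul_eq_zero,
    or_iff_right (pow_ne_zero 2 hG)]

theorem cons_one_ne_zero (a : F × F) : (![1, a.1, a.2] : Fin 3 → F) ≠ 0 := fun h =>
  one_ne_zero (congrFun h 0)

theorem injective_mk_cons_one : Function.Injective fun a : F × F =>
    Projectivization.mk F ![1, a.1, a.2] (cons_one_ne_zero a) := by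
  intro a b hab
  obtain ⟨c, hc⟩ := (Projectivization.mk_eq_mk_iff' F _ _ _ _).1 hab
  obtain rfl : c = 1 := (mul_one c).symm.trans (congrFun hc 0)
  rw [one_smul] at hc
  exact Prod.ext (congrFun hc 1).symm (congrFun hc 2).symm

theorem ncard_eq_four_of_mk_mem_iff [NeZero (2 : F)] {S : Set (Line F)} {p q : F} (hp : p ≠ 0)
    (hq : q ≠ 0)
    (hS : ∀ w hw, Projectivization.mk F w hw ∈ S ↔
      w 1 ^ 2 = (p * w 0) ^ 2 ∧ w 2 ^ 2 = (q * w 0) ^ 2) : S.ncard = 4 := by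
  have himage : S = (fun a : F × F => Projectivization.mk F ![1, a.1, a.2] (cons_one_ne_zero a)) ''
      ({p, -p} ×ˢ {q, -q}) := by
    ext u
    induction u using Projectivization.ind with | h w hw =>
    constructor
    · intro hu
      obtain ⟨h1, h2⟩ := (hS w hw).1 hu
      have h0 : w 0 ≠ 0 := fun h0 => hw <| by
        ext i
        rw [h0, mul_zero, zero_pow two_ne_zero] at h1 h2
        fin_cases i
        exacts [h0, pow_eq_zero_iff two_ne_zero |>.1 h1, pow_eq_zero_iff two_ne_zero |>.1 h2]
      refine ⟨(w 1 / w 0, w 2 / w 0), ⟨?_, ?_⟩, mk_eq_mk_of_smul_eq _ _ (a := (w 0)⁻¹) ?_⟩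
      · rwa [sq_eq_sq_iff_eq_or_eq_neg, ← neg_mul, ← div_eq_iff h0, ← div_eq_iff h0] at h1
      · rwa [sq_eq_sq_iff_eq_or_eq_neg, ← neg_mul, ← div_eq_iff h0, ← div_eq_iff h0] at h2
      · ext i
        fin_cases i
        exacts [inv_mul_cancel₀ h0, inv_mul_eq_div _ _, inv_mul_eq_div _ _]
    · rintro ⟨a, ⟨h1, h2⟩, ha⟩
      rw [← ha, hS]
      exact ⟨(sq_eq_sq_iff_eq_or_eq_neg.2 h1).trans (by rw [Matrix.cons_val_zero, mul_one]),
        (sq_eq_sq_iff_eq_or_eq_neg.2 h2).trans (by rw [Matrix.cons_val_zero, mul_one])⟩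
  have hne {x : F} (hx : x ≠ 0) : x ≠ -x := fun h =>
    mul_ne_zero two_ne_zero hx (by rw [two_mul, ← eq_neg_iff_add_eq_zero, ← h])
  rw [himage, Set.ncard_image_of_injective _ injective_mk_cons_one, Set.ncard_prod,
    Set.ncard_pair (hne hp), Set.ncard_pair (hne hq)]

end

/-- The action of the projective transformation `t⁻¹` on the complex lines. -/
def complexDual (t : GL (Fin 3) ℝ) : GL (Fin 3) ℂ :=
  dual (Matrix.GeneralLinearGroup.map Complex.ofRealHom t)⁻¹

theorem val_complexDual (t : GL (Fin 3) ℝ) :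
    (complexDual t : Mat ℂ) = (complexify (t : Mat ℝ))ᵀ := by
  rw [complexDual, val_dual, inv_inv]
  rfl

theorem complexify_conicImage_inv (t : GL (Fin 3) ℝ) (N : Mat ℝ) :
    complexify (conicImage t⁻¹ N) =
      (complexify (t : Mat ℝ))ᵀ * complexify N * complexify (t : Mat ℝ) := by
  rw [conicImage_inv]
  change ((t : Mat ℝ)ᵀ * N * (t : Mat ℝ)).map Complex.ofRealHom = _
  rw [Matrix.map_mul, Matrix.map_mul]
  rfl

theorem det_complexify (M : Mat ℝ) : (complexify M).det = M.det :=
  (RingHom.map_det Complex.ofRealHom M).symm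

theorem complexify_diagonal (x y z : ℝ) :
    complexify (Matrix.diagonal ![x, y, z]) = Matrix.diagonal ![(x : ℂ), (y : ℂ), (z : ℂ)] := by
  rw [complexify, Matrix.diagonal_map Complex.ofReal_zero]
  congr 1
  ext i
  fin_cases i <;> rfl

theorem isTangent_complexDual_smul_iff {t : GL (Fin 3) ℝ} {x y z : ℝ} (hx : x ≠ 0) (hy : y ≠ 0)
    (hz : z ≠ 0) {w : Fin 3 → ℂ} (hw : w ≠ 0) :
    IsTangent (complexify (conicImage t⁻¹ (Matrix.diagonal ![x, y, z])))
      (complexDual t • Projectivization.mk ℂ w hw) ↔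
    (y * z * w 0 ^ 2 + x * z * w 1 ^ 2 + x * y * w 2 ^ 2 : ℂ) = 0 := by
  have ht : (complexify (t : Mat ℝ)).det ≠ 0 := by
    rw [det_complexify, Complex.ofReal_ne_zero]
    exact t.isUnit.map Matrix.detMonoidHom |>.ne_zero
  have hdet : (Matrix.diagonal ![(x : ℂ), (y : ℂ), (z : ℂ)]).det ≠ 0 := by
    rw [Matrix.det_diagonal, Fin.prod_univ_three]
    exact mul_ne_zero (mul_ne_zero (Complex.ofReal_ne_zero.2 hx) (Complex.ofReal_ne_zero.2 hy))
      (Complex.ofReal_ne_zero.2 hz)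
  simp only [smul_mk, val_complexDual, complexify_conicImage_inv, complexify_diagonal]
  rw [isTangent_transpose_mul_mul_mk_iff ht (Matrix.isSymm_diagonal _) hdet,
    quad_adjugate_diagonal]

theorem conicImage_inv_conicImage (t : GL (Fin 3) ℝ) (M : Mat ℝ) :
    conicImage t⁻¹ (conicImage t M) = M := by
  rw [← conicImage_mul, inv_mul_cancel, conicImage_one]

theorem smul_axisConic (s a b : ℝ) :
    s • axisConic a b = Matrix.diagonal ![s / a, s / b, -s] := by
  rw [axisConic, ← Matrix.diagonal_smul]
  congr 1
  ext i
  fin_cases i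
  exacts [mul_one_div s a, mul_one_div s b, mul_neg_one s]

theorem isTangent_complexDual_smul_iff_of_conicImage_eq {t : GL (Fin 3) ℝ} {M : Mat ℝ}
    {s a b : ℝ} (hs : s ≠ 0) (ha : a ≠ 0) (hb : b ≠ 0) (hM : conicImage t M = s • axisConic a b)
    {w : Fin 3 → ℂ} (hw : w ≠ 0) :
    IsTangent (complexify M) (complexDual t • Projectivization.mk ℂ w hw) ↔
      w 2 ^ 2 = a * w 0 ^ 2 + b * w 1 ^ 2 := by
  have hsC : (s : ℂ) ≠ 0 := Complex.ofReal_ne_zero.2 hs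
  have haC : (a : ℂ) ≠ 0 := Complex.ofReal_ne_zero.2 ha
  have hbC : (b : ℂ) ≠ 0 := Complex.ofReal_ne_zero.2 hb
  have heq : (((s / b : ℝ) : ℂ) * (-s : ℝ) * w 0 ^ 2 + (s / a : ℝ) * (-s : ℝ) * w 1 ^ 2 +
      (s / a : ℝ) * (s / b : ℝ) * w 2 ^ 2) =
      s ^ 2 / (a * b) * (w 2 ^ 2 - (a * w 0 ^ 2 + b * w 1 ^ 2)) := by
    push_cast
    field_simp
    ring
  rw [← conicImage_inv_conicImage t M, hM, smul_axisConic,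
    isTangent_complexDual_smul_iff (div_ne_zero hs ha) (div_ne_zero hs hb) (neg_ne_zero.2 hs), heq,
    mul_eq_zero, or_iff_right (div_ne_zero (pow_ne_zero 2 hsC) (mul_ne_zero haC hbC)), sub_eq_zero]

end CommonTangents

section NormalForm

/-- The projective transformation `t` takes `γ` to the unit circle and `Γ` to the ellipse
`x² / A + y² / B = 1`, and `m` is the parameter of the Jacobi functions that belongs to this pair of
conics. -/
structure IsNormalization (m A B : ℝ) (t : GL (Fin 3) ℝ) (γ Γ : Mat ℝ) : Prop where
  m_nonneg : 0 ≤ m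
  m_lt_one : m < 1
  one_lt : 1 < A
  sub_one_eq : A - 1 = (1 - m) * (B - 1)
  inner_eq : ∃ s : ℝ, s ≠ 0 ∧ conicImage t γ = s • axisConic 1 1
  outer_eq : ∃ s : ℝ, s ≠ 0 ∧ conicImage t Γ = s • axisConic A B

variable {m A B : ℝ} {t : GL (Fin 3) ℝ} {γ Γ : Mat ℝ}

theorem exists_isNormalization (hγ : IsEllipse γ) (hΓ : IsEllipse Γ) (h : Nested γ Γ) :
    ∃ m A B t, IsNormalization m A B t γ Γ := by
  obtain ⟨t, s, s', A, B, hs, hs', hA, hAB, hγt, hΓt⟩ := exists_normalForm hγ hΓ h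
  have hB : 0 < B - 1 := by linarith
  refine ⟨1 - (A - 1) / (B - 1), A, B, t, ?_, ?_, hA, ?_, ⟨s, hs, hγt⟩, ⟨s', hs', hΓt⟩⟩
  · rw [sub_nonneg, div_le_one hB]
    linarith
  · exact sub_lt_self 1 (div_pos (by linarith) hB)
  · rw [sub_sub_cancel, div_mul_cancel₀ _ hB.ne']

namespace IsNormalization

variable (h : IsNormalization m A B t γ Γ)

include h

theorem one_sub_pos : 0 < 1 - m := sub_pos.2 h.m_lt_one

theorem one_lt_right : 1 < B := one_lt_of_sub_one_eq h.m_lt_one h.one_lt h.sub_one_eq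

theorem smul_locus_inner : t • locus γ = locus (axisConic 1 1) := by
  obtain ⟨s, hs, hγ⟩ := h.inner_eq
  rw [smul_locus, hγ, locus_smul hs]

theorem smul_locus_outer : t • locus Γ = locus (axisConic A B) := by
  obtain ⟨s, hs, hΓ⟩ := h.outer_eq
  rw [smul_locus, hΓ, locus_smul hs]

theorem complexDual_smul_mem_commonTangents_iff {w : Fin 3 → ℂ} (hw : w ≠ 0) :
    complexDual t • Projectivization.mk ℂ w hw ∈ commonTangents γ Γ ↔
      w 1 ^ 2 = -(1 - m) * w 0 ^ 2 ∧ w 2 ^ 2 = m * w 0 ^ 2 := by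
  obtain ⟨s, hs, hγ⟩ := h.inner_eq
  obtain ⟨s', hs', hΓ⟩ := h.outer_eq
  have hA : A ≠ 0 := (zero_lt_one.trans h.one_lt).ne'
  have hB : B ≠ 0 := (zero_lt_one.trans h.one_lt_right).ne'
  have hB1 : (B : ℂ) - 1 ≠ 0 := by exact_mod_cast (sub_pos.2 h.one_lt_right).ne'
  have hAB : (A : ℂ) - 1 = (1 - m) * (B - 1) := by exact_mod_cast h.sub_one_eq
  rw [commonTangents, Set.mem_ofPred_eq,
    isTangent_complexDual_smul_iff_of_conicImage_eq hs one_ne_zero one_ne_zero hγ,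
    isTangent_complexDual_smul_iff_of_conicImage_eq hs' hA hB hΓ, Complex.ofReal_one]
  constructor
  · rintro ⟨h1, h2⟩
    have h3 : w 1 ^ 2 = -(1 - m) * w 0 ^ 2 :=
      mul_left_cancel₀ hB1 (by linear_combination h1 - h2 - w 0 ^ 2 * hAB)
    exact ⟨h3, by linear_combination h1 + h3⟩
  · rintro ⟨h1, h2⟩
    exact ⟨by linear_combination h2 - h1, by linear_combination h2 - B * h1 - w 0 ^ 2 * hAB⟩

theorem isTangent_of_mem_commonTangents {x y z : ℝ} (hx : x ≠ 0) (hy : y ≠ 0) (hz : z ≠ 0)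
    (hxyz : y * z - (1 - m) * (x * z) + m * (x * y) = 0) {u : Line ℂ}
    (hu : u ∈ commonTangents γ Γ) :
    IsTangent (complexify (conicImage t⁻¹ (Matrix.diagonal ![x, y, z]))) u := by
  obtain ⟨u, rfl⟩ := MulAction.surjective (complexDual t) u
  induction u using Projectivization.ind with | h w hw =>
  have hC : (y * z - (1 - m) * (x * z) + m * (x * y) : ℂ) = 0 := by exact_mod_cast hxyz
  obtain ⟨h1, h2⟩ := (h.complexDual_smul_mem_commonTangents_iff hw).1 hu
  rw [isTangent_complexDual_smul_iff hx hy hz]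
  linear_combination (x * z : ℂ) * h1 + (x * y : ℂ) * h2 + w 0 ^ 2 * hC

theorem ncard_commonTangents (hm : m ≠ 0) : (commonTangents γ Γ).ncard = 4 := by
  have hp : (√(1 - m) : ℂ) ^ 2 = 1 - m := by exact_mod_cast Real.sq_sqrt h.one_sub_pos.le
  have hq : (√m : ℂ) ^ 2 = m := by exact_mod_cast Real.sq_sqrt h.m_nonneg
  have hp0 : Complex.I * √(1 - m) ≠ 0 := mul_ne_zero Complex.I_ne_zero
    (Complex.ofReal_ne_zero.2 (Real.sqrt_ne_zero'.2 h.one_sub_pos))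
  have hq0 : (√m : ℂ) ≠ 0 :=
    Complex.ofReal_ne_zero.2 (Real.sqrt_ne_zero'.2 (h.m_nonneg.lt_of_ne' hm))
  rw [← Set.ncard_smul_set (complexDual t)⁻¹]
  refine ncard_eq_four_of_mk_mem_iff hp0 hq0 fun w hw => ?_
  rw [Set.mem_inv_smul_set_iff, h.complexDual_smul_mem_commonTangents_iff, mul_pow, mul_pow,
    mul_pow, hp, hq, Complex.I_sq, neg_one_mul]

theorem ne_zero_of_not_projectivelyConcentric (hnc : ¬ ProjectivelyConcentric γ Γ) : m ≠ 0 := by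
  rintro rfl
  obtain rfl : A = B := by linarith [h.sub_one_eq]
  have hA : 0 < A := zero_lt_one.trans h.one_lt
  refine hnc ⟨t, 1, √A, one_pos, Real.sqrt_pos.2 hA, ?_, ?_⟩
  · rw [h.smul_locus_inner, one_pow]
  · rw [h.smul_locus_outer, Real.sq_sqrt hA.le]

theorem exists_units_sq_eq : ∃ e : ℝˣ, (e : ℝ) ^ 2 = 1 - m :=
  ⟨Units.mk0 √(1 - m) (Real.sqrt_ne_zero'.2 h.one_sub_pos), Real.sq_sqrt h.one_sub_pos.le⟩

theorem areConfocal {e : ℝˣ} (he : (e : ℝ) ^ 2 = 1 - m) :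
    AreConfocal (conicImage (diagGL 1 e * t) γ) (conicImage (diagGL 1 e * t) Γ) := by
  have hlocus (a b : ℝ) :
      diagGL 1 e • locus (axisConic a b) = locus (axisConic a ((1 - m) * b)) := by
    rw [smul_locus, axisConic, conicImage_diagGL_diagonal, he, axisConic, Units.val_one, one_pow,
      div_one, div_div, mul_comm b]
  refine ⟨1, 1 - m, A - 1, one_pos, h.one_sub_pos, sub_pos.2 h.one_lt, ?_, ?_⟩
  · rw [← smul_locus, mul_smul, h.smul_locus_inner, hlocus, mul_one]
  · rw [← smul_locus, mul_smul, h.smul_locus_outer, hlocus, add_sub_cancel,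
      show (1 - m) * B = 1 - m + (A - 1) by linarith [h.sub_one_eq]]

end IsNormalization

end NormalForm

section AffineType

theorem isEllipse_axisConic {a b : ℝ} (ha : 0 < a) (hb : 0 < b) : IsEllipse (axisConic a b) := by
  have ha' : 0 < 1 / a := one_div_pos.2 ha
  have hb' : 0 < 1 / b := one_div_pos.2 hb
  refine ⟨isSymm_axisConic a b, ?_, ?_⟩
  · simpa [axisConic] using mul_pos ha' hb'
  · rw [det_axisConic]
    exact mul_neg_of_pos_of_neg (add_pos ha' hb') (neg_lt_zero.2 (mul_pos ha' hb'))

theorem inside_axisConic_mk_iff {a b : ℝ} (ha : 0 < a) (hb : 0 < b) {w : Fin 3 → ℝ} (hw : w ≠ 0) :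
    Inside (axisConic a b) (Projectivization.mk ℝ w hw) ↔ quad (axisConic a b) w < 0 := by
  have hpos : 0 < axisConic a b 0 0 + axisConic a b 1 1 :=
    add_pos (one_div_pos.2 ha) (one_div_pos.2 hb)
  rw [inside_mk]
  exact ⟨fun h => neg_of_mul_neg_right h hpos.le, mul_neg_of_pos_of_neg hpos⟩

theorem quad_axisConic_neg_of_nonpos {a b a' b' : ℝ} (ha : 0 < a) (hb : 0 < b) (haa' : a < a')
    (hbb' : b < b') {w : Fin 3 → ℝ} (hw : w ≠ 0) (h : quad (axisConic a b) w ≤ 0) :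
    quad (axisConic a' b') w < 0 := by
  rw [quad_axisConic] at h ⊢
  have h0 : w 0 ^ 2 / a' ≤ w 0 ^ 2 / a := div_le_div_of_nonneg_left (sq_nonneg _) ha haa'.le
  have h1 : w 1 ^ 2 / b' ≤ w 1 ^ 2 / b := div_le_div_of_nonneg_left (sq_nonneg _) hb hbb'.le
  by_cases hw0 : w 0 = 0
  · by_cases hw1 : w 1 = 0
    · have hw2 : w 2 ≠ 0 := fun hw2 => hw (by ext i; fin_cases i; exacts [hw0, hw1, hw2])
      have : 0 < w 2 ^ 2 := by positivity
      simpa [hw0, hw1] using this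
    · have : w 1 ^ 2 / b' < w 1 ^ 2 / b := div_lt_div_of_pos_left (by positivity) hb hbb'
      linarith
  · have : w 0 ^ 2 / a' < w 0 ^ 2 / a := div_lt_div_of_pos_left (by positivity) ha haa'
    linarith

theorem nested_axisConic {a b a' b' : ℝ} (ha : 0 < a) (hb : 0 < b) (haa' : a < a')
    (hbb' : b < b') : Nested (axisConic a b) (axisConic a' b') := by
  intro p hp
  induction p using Projectivization.ind with | h w hw =>
  rw [mk_mem_locus, inside_axisConic_mk_iff ha hb] at hp
  rw [inside_axisConic_mk_iff (ha.trans haa') (hb.trans hbb')]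
  exact quad_axisConic_neg_of_nonpos ha hb haa' hbb' hw (hp.elim Eq.le le_of_lt)

theorem isHyperbola_diagonal {x y z : ℝ} (hxy : x * y < 0) (hz : z ≠ 0) :
    IsHyperbola (Matrix.diagonal ![x, y, z]) := by
  refine ⟨Matrix.isSymm_diagonal _, by simpa using hxy, ?_⟩
  rw [Matrix.det_diagonal, Fin.prod_univ_three]
  exact mul_ne_zero hxy.ne hz

theorem quad_adjugate_cons_zero_zero_one {M : Mat ℝ} (hM : M.IsSymm) :
    quad M.adjugate ![0, 0, 1] = M 0 0 * M 1 1 - M 0 1 ^ 2 := by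
  rw [Matrix.adjugate_fin_three, sq, ← hM.apply 0 1]
  simp [quad, dotProduct, Matrix.mulVec, Fin.sum_univ_three]

theorem minor_conicImage_inv (t : GL (Fin 3) ℝ) (x y z : ℝ) :
    conicImage t⁻¹ (Matrix.diagonal ![x, y, z]) 0 0 *
        conicImage t⁻¹ (Matrix.diagonal ![x, y, z]) 1 1 -
      conicImage t⁻¹ (Matrix.diagonal ![x, y, z]) 0 1 ^ 2 =
    y * z * ((t : Mat ℝ).adjugateᵀ *ᵥ ![0, 0, 1]) 0 ^ 2 +
      x * z * ((t : Mat ℝ).adjugateᵀ *ᵥ ![0, 0, 1]) 1 ^ 2 +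
      x * y * ((t : Mat ℝ).adjugateᵀ *ᵥ ![0, 0, 1]) 2 ^ 2 := by
  rw [← quad_adjugate_cons_zero_zero_one (isSymm_conicImage (Matrix.isSymm_diagonal _) _),
    conicImage_inv, quad_adjugate_transpose_mul_mul, quad_adjugate_diagonal]

theorem minor_diagonal_neg {x y z w₀ w₁ w₂ : ℝ} (hx : 0 < x) (hy : y < 0) (hz : z < 0)
    (hzx : -x ≤ z) (hw : w₀ ^ 2 + w₁ ^ 2 < w₂ ^ 2) :
    y * z * w₀ ^ 2 + x * z * w₁ ^ 2 + x * y * w₂ ^ 2 < 0 := by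
  have h0 : y * z * w₀ ^ 2 ≤ y * -x * w₀ ^ 2 :=
    mul_le_mul_of_nonneg_right (mul_le_mul_of_nonpos_left hzx hy.le) (sq_nonneg _)
  have h1 : x * z * w₁ ^ 2 ≤ x * -y * w₁ ^ 2 :=
    mul_le_mul_of_nonneg_right
      (mul_le_mul_of_nonneg_left (hz.le.trans (neg_nonneg.2 hy.le)) hx.le) (sq_nonneg _)
  have h2 : x * y * (w₂ ^ 2 - (w₀ ^ 2 + w₁ ^ 2)) < 0 :=
    mul_neg_of_neg_of_pos (mul_neg_of_pos_of_neg hx hy) (sub_pos.2 hw)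
  linarith

theorem IsNormalization.isHyperbola_conicImage_inv_diagonal {m A B : ℝ} {t : GL (Fin 3) ℝ}
    {γ Γ : Mat ℝ} (h : IsNormalization m A B t γ Γ) (hγ : IsEllipse γ) {x y z : ℝ} (hx : 0 < x)
    (hy : y < 0) (hz : z < 0) (hzx : -x ≤ z) :
    IsHyperbola (conicImage t⁻¹ (Matrix.diagonal ![x, y, z])) := by
  have hdet : (Matrix.diagonal ![x, y, z]).det ≠ 0 := by
    rw [Matrix.det_diagonal, Fin.prod_univ_three]
    exact mul_ne_zero (mul_ne_zero hx.ne' hy.ne) hz.ne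
  refine ⟨isSymm_conicImage (Matrix.isSymm_diagonal _) _, ?_, det_conicImage_ne_zero hdet _⟩
  obtain ⟨s, -, hs⟩ := h.inner_eq
  have hminor := hγ.2.1
  rw [← conicImage_inv_conicImage t γ, hs, smul_axisConic, minor_conicImage_inv] at hminor
  rw [minor_conicImage_inv]
  refine minor_diagonal_neg hx hy hz hzx (sub_pos.1 (pos_of_mul_pos_right ?_ (sq_nonneg s)))
  linear_combination hminor

end AffineType

section CoordinateConics

/-- The conic of the points `h.point x y` with fixed `y`, for `h : IsAmplitude m K φ`. -/
def coordEllipse (m : ℝ) (φ : ℝ → ℝ) (y : ℝ) : Mat ℝ :=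
  axisConic (dn m φ y ^ 2 / cn φ y ^ 2) (1 / cn φ y ^ 2)

/-- The conic of the points `h.point x y` with fixed `x`, for `h : IsAmplitude m K φ`. -/
def coordHyperbola (m : ℝ) (φ : ℝ → ℝ) (x : ℝ) : Mat ℝ :=
  Matrix.diagonal ![1 / sn φ x ^ 2, -((1 - m) / cn φ x ^ 2), -m]

namespace IsAmplitude

variable {m K : ℝ} {φ : ℝ → ℝ} (h : IsAmplitude m K φ)

include h

theorem dn_sq_eq (x : ℝ) : dn m φ x ^ 2 = 1 - m + m * cn φ x ^ 2 := by
  linear_combination h.dn_sq x - m * sn_sq_add_cn_sq φ x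

theorem dn_sq_div_cn_sq {y : ℝ} (hy : cn φ y ≠ 0) :
    dn m φ y ^ 2 / cn φ y ^ 2 = m + (1 - m) / cn φ y ^ 2 := by
  rw [h.dn_sq_eq, add_div, mul_div_cancel_right₀ _ (pow_ne_zero 2 hy), add_comm]

theorem point_mem_locus_coordEllipse (x y : ℝ) :
    h.point x y ∈ locus (coordEllipse m φ y) := by
  have hd := (h.dn_pos y).ne'
  rw [point, mk_mem_locus, coordEllipse, quad_axisConic]
  simp only [Matrix.cons_val]
  field_simp
  linear_combination cn φ y ^ 2 * sn_sq_add_cn_sq φ x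

theorem point_mem_locus_coordHyperbola {x : ℝ} (hs : sn φ x ≠ 0) (hc : cn φ x ≠ 0) (y : ℝ) :
    h.point x y ∈ locus (coordHyperbola m φ x) := by
  rw [point, mk_mem_locus, coordHyperbola, quad_diagonal, Fin.sum_univ_three]
  simp only [Matrix.cons_val]
  field_simp
  linear_combination h.dn_sq_eq y

variable {e : ℝˣ} (he : (e : ℝ) ^ 2 = 1 - m)

include he

theorem conicImage_diagGL_coordEllipse {y : ℝ} (hy : cn φ y ≠ 0) :
    conicImage (diagGL 1 e) (coordEllipse m φ y) =
      axisConic (m + (1 - m) / cn φ y ^ 2) ((1 - m) / cn φ y ^ 2) := by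
  rw [coordEllipse, h.dn_sq_div_cn_sq hy, axisConic, conicImage_diagGL_diagonal, he, axisConic,
    Units.val_one, one_pow, div_one, div_div, div_mul_eq_mul_div, one_mul]

theorem isEllipse_conicImage_coordEllipse {y : ℝ} (hy : cn φ y ≠ 0) :
    IsEllipse (conicImage (diagGL 1 e) (coordEllipse m φ y)) := by
  have hpos : 0 < (1 - m) / cn φ y ^ 2 := div_pos (sub_pos.2 h.m_lt_one) (by positivity)
  rw [h.conicImage_diagGL_coordEllipse he hy]
  exact isEllipse_axisConic (add_pos_of_nonneg_of_pos h.m_nonneg hpos) hpos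

theorem nested_conicImage_coordEllipse {y y' : ℝ} (hy' : cn φ y' ≠ 0)
    (hlt : cn φ y' ^ 2 < cn φ y ^ 2) :
    Nested (conicImage (diagGL 1 e) (coordEllipse m φ y))
      (conicImage (diagGL 1 e) (coordEllipse m φ y')) := by
  have hb : 0 < 1 - m := sub_pos.2 h.m_lt_one
  have hc' : 0 < cn φ y' ^ 2 := by positivity
  have hc : 0 < cn φ y ^ 2 := hc'.trans hlt
  have hpos : 0 < (1 - m) / cn φ y ^ 2 := div_pos hb hc
  have hdiv : (1 - m) / cn φ y ^ 2 < (1 - m) / cn φ y' ^ 2 := div_lt_div_of_pos_left hb hc' hlt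
  rw [h.conicImage_diagGL_coordEllipse he (pow_ne_zero_iff two_ne_zero |>.1 hc.ne'),
    h.conicImage_diagGL_coordEllipse he hy']
  exact nested_axisConic (add_pos_of_nonneg_of_pos h.m_nonneg hpos) hpos (by linarith) hdiv

omit he

variable {x : ℝ} (hs : sn φ x ≠ 0) (hc : cn φ x ≠ 0)

include hs hc

include he in
theorem isHyperbola_conicImage_coordHyperbola (hm : m ≠ 0) :
    IsHyperbola (conicImage (diagGL 1 e) (coordHyperbola m φ x)) := by
  rw [coordHyperbola, conicImage_diagGL_diagonal, he, Units.val_one, one_pow, div_one]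
  have hb : 0 < 1 - m := sub_pos.2 h.m_lt_one
  refine isHyperbola_diagonal (mul_neg_of_pos_of_neg (by positivity) ?_) (neg_ne_zero.2 hm)
  exact div_neg_of_neg_of_pos (neg_lt_zero.2 (div_pos hb (by positivity))) hb

theorem disjoint_locus_coordHyperbola (hm : m ≠ 0) {x' : ℝ} (hs' : sn φ x' ≠ 0)
    (hc' : cn φ x' ≠ 0) (hne : sn φ x ^ 2 ≠ sn φ x' ^ 2) :
    Disjoint (locus (coordHyperbola m φ x)) (locus (coordHyperbola m φ x')) := by
  have hb : 0 < 1 - m := sub_pos.2 h.m_lt_one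
  rw [Set.disjoint_left]
  intro p hp hp'
  induction p using Projectivization.ind with | h w hw =>
  rw [mk_mem_locus, coordHyperbola, quad_diagonal, Fin.sum_univ_three] at hp hp'
  simp only [Matrix.cons_val] at hp hp'
  have hmul : (sn φ x' ^ 2 - sn φ x ^ 2) * ((cn φ x * cn φ x' * w 0) ^ 2 +
      (1 - m) * (sn φ x * sn φ x' * w 1) ^ 2) = 0 := by
    field_simp at hp hp'
    linear_combination sn φ x' ^ 2 * cn φ x' ^ 2 * hp - sn φ x ^ 2 * cn φ x ^ 2 * hp' +
      (1 - m) * (sn φ x * sn φ x' * w 1) ^ 2 *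
        (sn_sq_add_cn_sq φ x' - sn_sq_add_cn_sq φ x)
  have hsum := (mul_eq_zero.1 hmul).resolve_left (sub_ne_zero.2 hne.symm)
  obtain ⟨h0, h1⟩ := (add_eq_zero_iff_of_nonneg (sq_nonneg _)
    (mul_nonneg hb.le (sq_nonneg _))).1 hsum
  have hw0 : w 0 = 0 := by simpa [hc, hc'] using h0
  have hw1 : w 1 = 0 := by simpa [hs, hs', hb.ne'] using h1
  have hw2 : w 2 = 0 := by simpa [hw0, hw1, hm] using hp
  exact hw (by ext i; fin_cases i; exacts [hw0, hw1, hw2])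

end IsAmplitude

end CoordinateConics

section PonceletGridConics

theorem linearlyEquivalent_of_diagGL (e : ℝˣ) (t : GL (Fin 3) ℝ) {X Y : Set (Plane ℝ)}
    (h : ∃ a b, diagGL a b • t • X = t • Y) : LinearlyEquivalent (diagGL 1 e * t) X Y := by
  obtain ⟨a, b, hab⟩ := h
  have hcomm : diagGL a b * diagGL 1 e = diagGL 1 e * diagGL a b := by
    rw [diagGL_mul, diagGL_mul, mul_comm a, mul_comm b]
  have hconj : (diagGL 1 e * t)⁻¹ * diagGL a b * (diagGL 1 e * t) = t⁻¹ * (diagGL a b * t) := by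
    rw [mul_assoc, ← mul_assoc (diagGL a b), hcomm]
    group
  exact ⟨diagGL a b, isLinear_diagGL a b, by rw [hconj, mul_smul, mul_smul, hab, inv_smul_smul]⟩

theorem conicImage_mul_conicImage_inv (g t : GL (Fin 3) ℝ) (M : Mat ℝ) :
    conicImage (g * t) (conicImage t⁻¹ M) = conicImage g M := by
  rw [← conicImage_mul, mul_inv_cancel_right]

theorem subset_locus_conicImage_inv {t : GL (Fin 3) ℝ} {X : Set (Plane ℝ)} {M : Mat ℝ} :
    X ⊆ locus (conicImage t⁻¹ M) ↔ t • X ⊆ locus M := by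
  rw [← smul_locus, Set.subset_smul_set_iff, inv_inv]

theorem disjoint_locus_conicImage_iff {t : GL (Fin 3) ℝ} {M N : Mat ℝ} :
    Disjoint (locus (conicImage t M)) (locus (conicImage t N)) ↔
      Disjoint (locus M) (locus N) := by
  rw [← smul_locus, ← smul_locus, Set.disjoint_smul_set]

variable {n : ℕ} {m K A B u₀ δ : ℝ} {φ : ℝ → ℝ} {t : GL (Fin 3) ℝ} {γ Γ : Mat ℝ}
  {ℓ : ZMod n → Line ℝ} (h : IsAmplitude m K φ)

namespace IsAmplitude

include h

theorem cn_abs (x : ℝ) : cn φ |x| = cn φ x := by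
  rcases abs_choice x with hx | hx
  · rw [hx]
  · rw [hx, h.cn_neg]

theorem cn_sq_lt_cn_sq {x y : ℝ} (hx : 0 ≤ x) (hxy : x < y) (hy : y < K) :
    cn φ y ^ 2 < cn φ x ^ 2 := by
  have hφx : 0 ≤ φ x := h.map_zero ▸ h.strictMono.monotone hx
  have hφy : φ y < Real.pi / 2 := h.map_K ▸ h.strictMono hy
  have hφxy : φ x < φ y := h.strictMono hxy
  have hpos : 0 < cn φ y := Real.cos_pos_of_mem_Ioo ⟨by linarith [Real.pi_pos], hφy⟩
  exact pow_lt_pow_left₀ (Real.cos_lt_cos_of_nonneg_of_le_pi_div_two hφx hφy.le hφxy) hpos.le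
    two_ne_zero

variable (hδ : n * δ = 2 * K ∨ n * δ = -(2 * K))

include hδ

theorem mul_abs_eq : n * |δ| = 2 * K := by
  rw [← Nat.abs_cast, ← abs_mul, (abs_eq (mul_pos two_pos h.K_pos).le).2 hδ]

theorem cn_natCast_mul_sq_lt (hn : 0 < n) {j k : ℕ} (hjk : j < k) (hk : k ≤ (n - 1) / 2) :
    cn φ (k * δ) ^ 2 < cn φ (j * δ) ^ 2 := by
  have habs := h.mul_abs_eq hδ
  have hδpos : 0 < |δ| :=
    pos_of_mul_pos_right (habs ▸ mul_pos two_pos h.K_pos) (Nat.cast_nonneg n)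
  have hcn (i : ℕ) : cn φ (i * δ) = cn φ (i * |δ|) := by
    rw [← h.cn_abs (i * δ), abs_mul, Nat.abs_cast]
  have hkn : 2 * (k : ℝ) < n := by exact_mod_cast (by omega : 2 * k < n)
  have hjk' : (j : ℝ) * |δ| < k * |δ| :=
    mul_lt_mul_of_pos_right (by exact_mod_cast hjk) hδpos
  rw [hcn, hcn]
  exact h.cn_sq_lt_cn_sq (by positivity) hjk' (by linarith [mul_lt_mul_of_pos_right hkn hδpos])

variable (hℓ : ∀ i : ℤ, ℓ i = tangentLine φ (u₀ + 2 * i * δ))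

include hℓ

theorem gridP_subset_locus_coordEllipse (k : ℤ) :
    gridP (axisConic 1 1) ℓ k ⊆ locus (coordEllipse m φ (k * δ)) := by
  rw [h.gridP_eq hδ hℓ]
  exact Set.range_subset_iff.2 fun j => h.point_mem_locus_coordEllipse _ _

theorem gridQ_subset_locus_coordHyperbola (k : ℤ)
    (hsc : sn φ (u₀ + k * δ) ≠ 0 ∧ cn φ (u₀ + k * δ) ≠ 0) :
    gridQ (axisConic 1 1) ℓ k ⊆ locus (coordHyperbola m φ (u₀ + k * δ)) := by
  rw [h.gridQ_eq hδ hℓ]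
  exact Set.range_subset_iff.2 fun j => h.point_mem_locus_coordHyperbola hsc.1 hsc.2 _

end IsAmplitude

namespace IsNormalization

variable (hN : IsNormalization m A B t γ Γ)

include hN

variable {x : ℝ} (hs : sn φ x ≠ 0) (hc : cn φ x ≠ 0)

include hs hc

theorem isTangent_coordHyperbola (hm : m ≠ 0) {u : Line ℂ} (hu : u ∈ commonTangents γ Γ) :
    IsTangent (complexify (conicImage t⁻¹ (coordHyperbola m φ x))) u := by
  refine hN.isTangent_of_mem_commonTangents (one_div_ne_zero (pow_ne_zero 2 hs))
    (neg_ne_zero.2 (div_ne_zero hN.one_sub_pos.ne' (pow_ne_zero 2 hc))) (neg_ne_zero.2 hm) ?_ hu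
  field_simp
  linear_combination (m - m ^ 2) * sn_sq_add_cn_sq φ x

theorem isHyperbola_coordHyperbola (hγ : IsEllipse γ) (hm : m ≠ 0) :
    IsHyperbola (conicImage t⁻¹ (coordHyperbola m φ x)) := by
  have hS : 0 < sn φ x ^ 2 := by positivity
  have hS1 : sn φ x ^ 2 ≤ 1 := Real.sin_sq_le_one _
  refine hN.isHyperbola_conicImage_inv_diagonal hγ (one_div_pos.2 hS)
    (neg_neg_of_pos (div_pos hN.one_sub_pos (by positivity)))
    (neg_neg_of_pos (hN.m_nonneg.lt_of_ne' hm)) (neg_le_neg ?_)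
  exact hN.m_lt_one.le.trans (one_le_one_div hS hS1)

omit hs hc

include h

theorem isTangent_coordEllipse {y : ℝ} (hy : cn φ y ≠ 0) {u : Line ℂ}
    (hu : u ∈ commonTangents γ Γ) :
    IsTangent (complexify (conicImage t⁻¹ (coordEllipse m φ y))) u := by
  have hd := (h.dn_pos y).ne'
  have ha : dn m φ y ^ 2 / cn φ y ^ 2 ≠ 0 := div_ne_zero (pow_ne_zero 2 hd) (pow_ne_zero 2 hy)
  refine hN.isTangent_of_mem_commonTangents (one_div_ne_zero ha)
    (one_div_ne_zero (one_div_ne_zero (pow_ne_zero 2 hy))) (neg_ne_zero.2 one_ne_zero) ?_ hu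
  field_simp
  linear_combination -cn φ y ^ 2 * h.dn_sq_eq y

variable {e : ℝˣ} (he : (e : ℝ) ^ 2 = 1 - m) (hn : Odd n)
  (hδ : n * δ = 2 * K ∨ n * δ = -(2 * K))
  (hℓ : ∀ i : ℤ, dual t • ℓ i = tangentLine φ (u₀ + 2 * i * δ))

include he hn hδ hℓ

theorem exists_ellipses :
    ∃ E : ℕ → Mat ℝ,
      (∀ k ≤ (n - 1) / 2,
        IsEllipse (conicImage (diagGL 1 e * t) (E k)) ∧
        gridP γ ℓ (k : ZMod n) ⊆ locus (E k) ∧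
        ∀ u ∈ commonTangents γ Γ, IsTangent (complexify (E k)) u) ∧
      ∀ j k, j < k → k ≤ (n - 1) / 2 →
        Nested (conicImage (diagGL 1 e * t) (E j)) (conicImage (diagGL 1 e * t) (E k)) := by
  have hc (k : ℕ) : cn φ (k * δ) ≠ 0 := by simpa using h.cn_int_mul_ne_zero hδ hn k
  refine ⟨fun k => conicImage t⁻¹ (coordEllipse m φ (k * δ)), fun k _ => ⟨?_, ?_, fun u =>
    hN.isTangent_coordEllipse h (hc k)⟩, fun j k hjk hk => ?_⟩
  · rw [conicImage_mul_conicImage_inv]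
    exact h.isEllipse_conicImage_coordEllipse he (hc k)
  · rw [subset_locus_conicImage_inv, ← gridP_dual_smul hN.smul_locus_inner]
    simpa using h.gridP_subset_locus_coordEllipse hδ hℓ k
  · rw [conicImage_mul_conicImage_inv, conicImage_mul_conicImage_inv]
    exact h.nested_conicImage_coordEllipse he (hc k) (h.cn_natCast_mul_sq_lt hδ hn.pos hjk hk)

theorem exists_hyperbolas (hγ : IsEllipse γ) (hm : m ≠ 0)
    (hsc : ∀ k : ℤ, sn φ (u₀ + k * δ) ≠ 0 ∧ cn φ (u₀ + k * δ) ≠ 0) :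
    ∃ H : ZMod n → Mat ℝ,
      (∀ k, IsHyperbola (H k) ∧
        IsHyperbola (conicImage (diagGL 1 e * t) (H k)) ∧
        gridQ γ ℓ k ⊆ locus (H k) ∧
        ∀ u ∈ commonTangents γ Γ, IsTangent (complexify (H k)) u) ∧
      ∀ j k, j ≠ k → Disjoint (locus (H j)) (locus (H k)) := by
  choose l hl using exists_two_mul_intCast_eq hn
  refine ⟨fun k => conicImage t⁻¹ (coordHyperbola m φ (u₀ + ((2 * l k : ℤ) : ℝ) * δ)), fun k => ?_,
    fun j k hjk => ?_⟩
  · obtain ⟨hs, hc⟩ := hsc (2 * l k)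
    refine ⟨hN.isHyperbola_coordHyperbola hs hc hγ hm, ?_, ?_, fun u =>
      hN.isTangent_coordHyperbola hs hc hm⟩
    · rw [conicImage_mul_conicImage_inv]
      exact h.isHyperbola_conicImage_coordHyperbola he hs hc hm
    · rw [subset_locus_conicImage_inv, ← gridQ_dual_smul hN.smul_locus_inner]
      have hQ := h.gridQ_subset_locus_coordHyperbola (ℓ := fun i => dual t • ℓ i) hδ hℓ (2 * l k)
        ⟨hs, hc⟩
      rwa [hl] at hQ
  · refine disjoint_locus_conicImage_iff.2 (h.disjoint_locus_coordHyperbola (hsc _).1 (hsc _).2 hm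
      (hsc _).1 (hsc _).2 fun hsn => hjk ?_)
    push_cast at hsn
    rw [← hl j, ← hl k, h.intCast_two_mul_eq_of_sn_sq_eq hδ hsc hsn]

omit he

theorem linearlyEquivalent_gridP (e : ℝˣ) (j k : ZMod n) :
    LinearlyEquivalent (diagGL 1 e * t) (gridP γ ℓ j) (gridP γ ℓ k) := by
  refine linearlyEquivalent_of_diagGL e t ?_
  rw [← gridP_dual_smul hN.smul_locus_inner, ← gridP_dual_smul hN.smul_locus_inner]
  exact h.exists_diagGL_smul_gridP hδ hℓ hn j k

theorem linearlyEquivalent_gridQ (e : ℝˣ)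
    (hsc : ∀ k : ℤ, sn φ (u₀ + k * δ) ≠ 0 ∧ cn φ (u₀ + k * δ) ≠ 0) (j k : ZMod n) :
    LinearlyEquivalent (diagGL 1 e * t) (gridQ γ ℓ j) (gridQ γ ℓ k) := by
  refine linearlyEquivalent_of_diagGL e t ?_
  rw [← gridQ_dual_smul hN.smul_locus_inner, ← gridQ_dual_smul hN.smul_locus_inner]
  exact h.exists_diagGL_smul_gridQ hδ hℓ hn hsc j k

end IsNormalization

end PonceletGridConics

end PonceletGrid

end

theorem theorem1 (γ Γ : PonceletGrid.Mat ℝ)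
    (hγ : PonceletGrid.IsEllipse γ) (hΓ : PonceletGrid.IsEllipse Γ)
    (hnest : PonceletGrid.Nested γ Γ) :
    (¬ PonceletGrid.ProjectivelyConcentric γ Γ →
      (PonceletGrid.commonTangents γ Γ).ncard = 4) ∧
    ∃ T : GL (Fin 3) ℝ,
      PonceletGrid.AreConfocal (PonceletGrid.conicImage T γ) (PonceletGrid.conicImage T Γ) ∧
      ∀ (n : ℕ), Odd n → 3 ≤ n →
      ∀ (v : ZMod n → PonceletGrid.Plane ℝ) (ℓ : ZMod n → PonceletGrid.Line ℝ),
        PonceletGrid.IsPonceletPolygon γ Γ v → PonceletGrid.IsCyclicEnumeration γ v ℓ →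
        -- the sets `P_k` lie on nested ellipses with the common tangents of `γ` and `Γ`
        (∃ E : ℕ → PonceletGrid.Mat ℝ,
          (∀ k ≤ (n - 1) / 2,
            PonceletGrid.IsEllipse (PonceletGrid.conicImage T (E k)) ∧
            PonceletGrid.gridP γ ℓ (k : ZMod n) ⊆ PonceletGrid.locus (E k) ∧
            ∀ u ∈ PonceletGrid.commonTangents γ Γ,
              PonceletGrid.IsTangent (PonceletGrid.complexify (E k)) u) ∧
          ∀ j k, j < k → k ≤ (n - 1) / 2 →
            PonceletGrid.Nested (PonceletGrid.conicImage T (E j))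
              (PonceletGrid.conicImage T (E k))) ∧
        -- the sets `P_k` are equivalent to each other
        (∀ j k : ZMod n, PonceletGrid.LinearlyEquivalent T
          (PonceletGrid.gridP γ ℓ j) (PonceletGrid.gridP γ ℓ k)) ∧
        -- the same for the sets `Q_k`, with disjoint hyperbolas
        (PonceletGrid.HasNoSymmetry γ Γ v →
          (∃ H : ZMod n → PonceletGrid.Mat ℝ,
            (∀ k,
              PonceletGrid.IsHyperbola (H k) ∧
              PonceletGrid.IsHyperbola (PonceletGrid.conicImage T (H k)) ∧
              PonceletGrid.gridQ γ ℓ k ⊆ PonceletGrid.locus (H k) ∧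
              ∀ u ∈ PonceletGrid.commonTangents γ Γ,
                PonceletGrid.IsTangent (PonceletGrid.complexify (H k)) u) ∧
            ∀ j k, j ≠ k → Disjoint (PonceletGrid.locus (H j)) (PonceletGrid.locus (H k))) ∧
          ∀ j k : ZMod n, PonceletGrid.LinearlyEquivalent T
            (PonceletGrid.gridQ γ ℓ j) (PonceletGrid.gridQ γ ℓ k)) := by
  open PonceletGrid in
  obtain ⟨m, A, B, t, hN⟩ := exists_isNormalization hγ hΓ hnest
  obtain ⟨K, φ, h⟩ := exists_isAmplitude hN.m_nonneg hN.m_lt_one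
  obtain ⟨e, he⟩ := hN.exists_units_sq_eq
  have hγt := hN.smul_locus_inner
  have hΓt := hN.smul_locus_outer
  refine ⟨fun hnc => hN.ncard_commonTangents (hN.ne_zero_of_not_projectivelyConcentric hnc),
    diagGL 1 e * t, hN.areConfocal he, fun n hn hn3 v ℓ hv hcyc => ?_⟩
  have hvt := hv.smul hγt hΓt
  have hcyct := hcyc.smul hγt
  obtain ⟨t₀, hside⟩ := h.exists_isSide_eq hN.one_lt hN.sub_one_eq hn3 hvt
  obtain ⟨u₀, δ, hδ, hℓ⟩ := h.exists_enumeration hn3 hcyct hside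
  refine ⟨hN.exists_ellipses h he hn hδ hℓ, hN.linearlyEquivalent_gridP h hn hδ hℓ e,
    fun hsym => ?_⟩
  have hsymt := hsym.smul hγt hΓt
  have hn2 : 2 ≤ n := Nat.le_of_succ_le hn3
  have hm := h.ne_zero_of_hasNoSymmetry hN.one_lt hN.sub_one_eq hn2 hvt hcyct.1 hℓ hsymt
  have hsc (k : ℤ) : sn φ (u₀ + k * δ) ≠ 0 ∧ cn φ (u₀ + k * δ) ≠ 0 :=
    ⟨h.sn_ne_zero_of_hasNoSymmetry hN.one_lt hN.sub_one_eq hn2 hvt hcyct.1 hℓ hsymt k,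
      h.cn_ne_zero_of_hasNoSymmetry hN.one_lt hN.sub_one_eq hn2 hvt hcyct.1 hℓ hsymt k⟩
  exact ⟨hN.exists_hyperbolas h he hn hδ hℓ hγ hm hsc,
    hN.linearlyEquivalent_gridQ h hn hδ hℓ e hsc⟩
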